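/- Let $M,N,L$ be nonnegative integers with $L\le\min\{M,N\}$, let $P\ge 0$, $\varepsilon\ge 0$ and $\sigma_n\in\mathbb R$, and let $\tilde{\mathbf H}\in\mathbb C^{M\times N}$ have the singular value decomposition $\tilde{\mathbf H}=\mathbf U_h\mathbf\Sigma_h\mathbf V_h^H$, where $\mathbf U_h\in\mathbb C^{M\times M}$ and $\mathbf V_h\in\mathbb C^{N\times N}$ are unitary and $\mathbf\Sigma_h\in\mathbb R^{M\times N}$ is zero off its main diagonal and carries there the singular values $\gamma_1\ge\gamma_2\ge\cdots\ge\gamma_{\min\{M,N\}}\ge 0$. Consider the robust problem $$\min_{\mathbf F\in\mathbb C^{N\times L},\ \mathbf G\in\mathbb C^{L\times M}}\ \max_{\mathbf E\in\mathbb C^{M\times N},\ \|\mathbf E\|_F\le\varepsilon}\ \|\mathbf G(\tilde{\mathbf H}+\mathbf E)\mathbf F-\mathbf I\|_F^2+\sigma_n^2\|\mathbf G\|_F^2\quad\text{subject to}\quad \operatorname{tr}(\mathbf F\mathbf F^H)\le P,$$ where $\|\cdot\|_F$ is the Frobenius norm and $\mathbf I$ is the $L\times L$ identity matrix. Then there are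 real diagonal $L\times L$ matrices $\hat{\mathbf\Sigma}_f$, $\hat{\mathbf\Sigma}_g$ and $\hat{\mathbf\Delta}_D$ such that, with $\mathbf\Sigma_f=[\hat{\mathbf\Sigma}_f,\mathbf 0]^T\in\mathbb R^{N\times L}$, $\mathbf\Sigma_g=[\hat{\mathbf\Sigma}_g,\mathbf 0]\in\mathbb R^{L\times M}$ and $\mathbf\Delta_D=\operatorname{diag}\{\hat{\mathbf\Delta}_D,\mathbf 0\}\in\mathbb R^{M\times N}$, the pair $$\mathbf F=\mathbf V_h\mathbf\Sigma_f,\qquad \mathbf G=\mathbf\Sigma_g\mathbf U_h^H$$ is an optimal solution of the robust problem (it satisfies the power constraint, and its worst-case objective value is at most that of every pair satisfying the power constraint), and $\mathbf E=\mathbf U_h\mathbf\Delta_D\mathbf V_h^H$ is a worst-case channel error for this pair: $\|\mathbf E\|_F\le\varepsilon$, and $\mathbf E$ maximizes the objective at $(\mathbf F,\mathbf G)$ over all errors of Frobenius norm at most $\varepsilon$. -/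

import Mathlib

open scoped Matrix Matrix.Norms.Frobenius

/-- The `m × n` complex matrix whose `(i, i)` entries are the real numbers `d i` for `i < k`,
all other entries being zero. -/
noncomputable def rectDiag (m n : ℕ) {k : ℕ} (d : Fin k → ℝ) : Matrix (Fin m) (Fin n) ℂ :=
  Matrix.of fun i j => if h : (i : ℕ) = (j : ℕ) ∧ (i : ℕ) < k then ((d ⟨i, h.2⟩ : ℝ) : ℂ) else 0

/-- `H = U Σ Vᴴ` is a singular value decomposition of `H`, with the singular values
`γ 0 ≥ γ 1 ≥ ⋯ ≥ 0` on the main diagonal of `Σ`. -/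
structure IsSVD {M N : ℕ} (H : Matrix (Fin M) (Fin N) ℂ) (U : Matrix (Fin M) (Fin M) ℂ)
    (γ : Fin (min M N) → ℝ) (V : Matrix (Fin N) (Fin N) ℂ) : Prop where
  left_unitary : U ∈ Matrix.unitaryGroup (Fin M) ℂ
  right_unitary : V ∈ Matrix.unitaryGroup (Fin N) ℂ
  nonneg : ∀ i, 0 ≤ γ i
  antitone : Antitone γ
  eq_mul : H = U * rectDiag M N γ * Vᴴ

/-- The mean-square error `‖G (H + E) F - I‖² + σ² ‖G‖²` (Frobenius norms) of the precoder `F` and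
the equalizer `G`, for the nominal channel `H`, the channel error `E` and the noise variance `σ²`. -/
noncomputable def mse {M N L : ℕ} (H : Matrix (Fin M) (Fin N) ℂ) (σ : ℝ)
    (F : Matrix (Fin N) (Fin L) ℂ) (G : Matrix (Fin L) (Fin M) ℂ)
    (E : Matrix (Fin M) (Fin N) ℂ) : ℝ :=
  ‖G * (H + E) * F - 1‖ ^ 2 + σ ^ 2 * ‖G‖ ^ 2

/-- The value of the inner problem: the maximum of the mean-square error over `‖E‖ ≤ ε`. -/
noncomputable def worstCaseMSE {M N L : ℕ} (H : Matrix (Fin M) (Fin N) ℂ) (ε σ : ℝ)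
    (F : Matrix (Fin N) (Fin L) ℂ) (G : Matrix (Fin L) (Fin M) ℂ) : ℝ :=
  sSup (mse H σ F G '' {E | ‖E‖ ≤ ε})

/-- `E` is a worst-case channel error for the pair `(F, G)`: it attains the inner maximum. -/
def IsWorstCaseError {M N L : ℕ} (H : Matrix (Fin M) (Fin N) ℂ) (ε σ : ℝ)
    (F : Matrix (Fin N) (Fin L) ℂ) (G : Matrix (Fin L) (Fin M) ℂ)
    (E : Matrix (Fin M) (Fin N) ℂ) : Prop :=
  ‖E‖ ≤ ε ∧ ∀ E' : Matrix (Fin M) (Fin N) ℂ, ‖E'‖ ≤ ε → mse H σ F G E' ≤ mse H σ F G E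

/-- The transmit power constraint `tr (F Fᴴ) ≤ P` (the trace is a real number). -/
def PowerFeasible {N L : ℕ} (P : ℝ) (F : Matrix (Fin N) (Fin L) ℂ) : Prop :=
  (F * Fᴴ).trace.re ≤ P

/-- `(F, G)` solves the robust problem: it is feasible and minimizes the worst-case mean-square
error among all pairs that satisfy the power constraint. -/
def IsRobustOptimal {M N L : ℕ} (H : Matrix (Fin M) (Fin N) ℂ) (P ε σ : ℝ)
    (F : Matrix (Fin N) (Fin L) ℂ) (G : Matrix (Fin L) (Fin M) ℂ) : Prop :=
  PowerFeasible P F ∧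
    ∀ (F' : Matrix (Fin N) (Fin L) ℂ) (G' : Matrix (Fin L) (Fin M) ℂ), PowerFeasible P F' →
      worstCaseMSE H ε σ F G ≤ worstCaseMSE H ε σ F' G'

/-- The inner maximum is attained, so that the supremum in `worstCaseMSE` is a maximum. -/
theorem exists_isWorstCaseError {M N L : ℕ} (H : Matrix (Fin M) (Fin N) ℂ) {ε : ℝ} (hε : 0 ≤ ε)
    (σ : ℝ) (F : Matrix (Fin N) (Fin L) ℂ) (G : Matrix (Fin L) (Fin M) ℂ) :
    ∃ E, IsWorstCaseError H ε σ F G E ∧ worstCaseMSE H ε σ F G = mse H σ F G E := by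
  have : ProperSpace (Matrix (Fin M) (Fin N) ℂ) := FiniteDimensional.proper ℂ _
  have hset : {E : Matrix (Fin M) (Fin N) ℂ | ‖E‖ ≤ ε} = Metric.closedBall 0 ε := by
    ext E
    simp
  have hc : IsCompact {E : Matrix (Fin M) (Fin N) ℂ | ‖E‖ ≤ ε} := by
    rw [hset]
    exact isCompact_closedBall _ _
  have hf : Continuous (mse H σ F G) := by
    unfold mse
    fun_prop
  obtain ⟨E, hE, hmax⟩ := hc.exists_isMaxOn ⟨0, by simpa using hε⟩ hf.continuousOn
  refine ⟨E, ⟨hE, fun E' hE' => hmax hE'⟩, ?_⟩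
  refine IsGreatest.csSup_eq ⟨⟨E, hE, rfl⟩, ?_⟩
  rintro _ ⟨E', hE', rfl⟩
  exact hmax hE'

/-! The problem reduces to `L` parallel scalar channels with gains `a i = f i * g i`: minimise over
a ≥ 0 the maximum, over x in the ball of radius ε, of ∑ (a_i (γ_i + x_i) - 1)² + τ (∑ a_i)², where τ
= σ²/P. A minimiser exists (`exists_optimal_gains`).

Attainment: with S = ∑ a_i, taking f_i² = P a_i / S and g_i² = S a_i / P respects the power and
produces noise τ S². Since (g_i f_j)² = a_i a_j, off-diagonal error energy does at least as much
harm when moved to the diagonal entry of largest gain, so a worst error is diagonal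
(`exists_diagonal_error_ge`).

Lower bound (`le_worstCaseMSE_of_forall_gains`): orthonormal factors of F and Gᴴ compress the
channel to an L × L block with singular values k_i ≤ γ_i, and weaker channels are no easier
(`exists_error_of_singularValues_le`). The objective is convex in the error, so a minimax theorem
does not apply directly. Let R be the product of the operator norms of F and G. Crediting unspent
error budget with (ε² - ‖x‖²) R² makes the objective concave in x for gains |a_i| ≤ R, and Sion's
theorem yields one x that is bad for all of them (`exists_saddle_error`). Against the fixed channel
diag(k + x), the pair (F, G) does no better than some gains with |a_i| ≤ R and ∑ |a_i| ≤ ‖F‖‖G‖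
(`exists_gains_le`). The credit is honest: a rank-one move along the top singular directions of G
and F realises it (`exists_error_ge`). Finally ‖F‖² ≤ P turns τ (‖F‖‖G‖)² into at most σ²‖G‖². -/

section FrobeniusNorm

/-! ### Frobenius norm: isometries, rank-one matrices, operator bounds. -/

variable {m n p : Type*} [Fintype m] [Fintype n] [Fintype p]

theorem frobenius_sq_eq_sum (A : Matrix m n ℂ) : ‖A‖ ^ 2 = ∑ i, ∑ j, ‖A i j‖ ^ 2 := by
  rw [Matrix.frobenius_norm_def, ← Real.sqrt_eq_rpow, Real.sq_sqrt (by positivity)]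
  simp

theorem frobenius_sq_eq_trace (A : Matrix m n ℂ) : ‖A‖ ^ 2 = (Aᴴ * A).trace.re := by
  rw [frobenius_sq_eq_sum, Finset.sum_comm]
  simp only [Matrix.trace, Matrix.diag, Matrix.mul_apply, Matrix.conjTranspose_apply,
    Complex.re_sum]
  refine Finset.sum_congr rfl fun j _ => Finset.sum_congr rfl fun i _ => ?_
  rw [← Complex.normSq_eq_norm_sq]
  simp [Complex.normSq_apply]

theorem frobenius_norm_isometry_mul [DecidableEq m] {W : Matrix p m ℂ} (hW : Wᴴ * W = 1)
    (A : Matrix m n ℂ) : ‖W * A‖ = ‖A‖ := by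
  rw [← sq_eq_sq₀ (norm_nonneg _) (norm_nonneg _), frobenius_sq_eq_trace, frobenius_sq_eq_trace,
    Matrix.conjTranspose_mul, Matrix.mul_assoc, ← Matrix.mul_assoc Wᴴ, hW, Matrix.one_mul]

theorem frobenius_norm_mul_coisometry [DecidableEq n] {W : Matrix p n ℂ} (hW : Wᴴ * W = 1)
    (A : Matrix m n ℂ) : ‖A * Wᴴ‖ = ‖A‖ := by
  rw [← Matrix.frobenius_norm_conjTranspose, Matrix.conjTranspose_mul,
    Matrix.conjTranspose_conjTranspose, frobenius_norm_isometry_mul hW,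
    Matrix.frobenius_norm_conjTranspose]

/-- Pythagoras: W Wᴴ A is an orthogonal projection of A and has the norm of Wᴴ A. -/
theorem frobenius_norm_coisometry_mul_le [DecidableEq m] {W : Matrix p m ℂ} (hW : Wᴴ * W = 1)
    (A : Matrix p n ℂ) : ‖Wᴴ * A‖ ≤ ‖A‖ := by
  have key : (A - W * (Wᴴ * A))ᴴ * (A - W * (Wᴴ * A)) = Aᴴ * A - (Wᴴ * A)ᴴ * (Wᴴ * A) := by
    have h1 : Wᴴ * (W * (Wᴴ * A)) = Wᴴ * A := by
      rw [← Matrix.mul_assoc, hW, Matrix.one_mul]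
    simp only [Matrix.conjTranspose_sub, Matrix.conjTranspose_mul, Matrix.sub_mul, Matrix.mul_sub,
      Matrix.conjTranspose_conjTranspose, Matrix.mul_assoc, h1]
    abel
  have h := congrArg (fun B => B.trace.re) key
  simp only [Matrix.trace_sub, Complex.sub_re, ← frobenius_sq_eq_trace] at h
  refine (sq_le_sq₀ (norm_nonneg _) (norm_nonneg _)).1 ?_
  nlinarith [sq_nonneg ‖A - W * (Wᴴ * A)‖]

theorem frobenius_norm_col_mul_row (u : Matrix m Unit ℂ) (w : Matrix Unit n ℂ) :
    ‖u * w‖ = ‖u‖ * ‖w‖ := by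
  rw [← sq_eq_sq₀ (norm_nonneg _) (by positivity), mul_pow]
  simp only [frobenius_sq_eq_sum, Matrix.mul_apply, Finset.univ_unique, Finset.sum_singleton,
    norm_mul, mul_pow]
  rw [Finset.sum_mul_sum]

/-- Here `q` is the real inner product of A and B; only the expansion in `t` is needed later. -/
theorem frobenius_sq_add_smul (A B : Matrix m n ℂ) :
    ∃ q : ℝ, ∀ t : ℝ, ‖A + (t : ℂ) • B‖ ^ 2 = ‖A‖ ^ 2 + 2 * t * q + t ^ 2 * ‖B‖ ^ 2 := by
  refine ⟨∑ i, ∑ j, ((A i j).re * (B i j).re + (A i j).im * (B i j).im), fun t => ?_⟩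
  simp only [frobenius_sq_eq_sum, Finset.mul_sum, ← Finset.sum_add_distrib]
  refine Finset.sum_congr rfl fun i _ => Finset.sum_congr rfl fun j _ => ?_
  simp only [← Complex.normSq_eq_norm_sq, Complex.normSq_apply, Matrix.add_apply,
    Matrix.smul_apply, smul_eq_mul, Complex.add_re, Complex.add_im, Complex.re_ofReal_mul,
    Complex.im_ofReal_mul]
  ring

/-- ‖Av‖² = ⟨v, AᴴAv⟩ ≤ ‖v‖ · c‖Av‖. -/
theorem frobenius_norm_colBound_of_conjTranspose {A : Matrix m n ℂ} {c : ℝ}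
    (hA : ∀ v : Matrix m Unit ℂ, ‖Aᴴ * v‖ ≤ c * ‖v‖) (hc : 0 ≤ c) (v : Matrix n Unit ℂ) :
    ‖A * v‖ ≤ c * ‖v‖ := by
  have h1 : ‖A * v‖ ^ 2 ≤ ‖vᴴ * (Aᴴ * (A * v))‖ := by
    rw [← Matrix.mul_assoc, ← Matrix.conjTranspose_mul, frobenius_sq_eq_trace]
    set B : Matrix Unit Unit ℂ := (A * v)ᴴ * (A * v)
    have hB : ‖B‖ = ‖B () ()‖ := by
      rw [← sq_eq_sq₀ (norm_nonneg _) (norm_nonneg _), frobenius_sq_eq_sum]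
      simp
    rw [hB]
    simpa [Matrix.trace] using Complex.re_le_norm (B () ())
  have h2 := (h1.trans (Matrix.frobenius_norm_mul _ _)).trans
    (mul_le_mul_of_nonneg_left (hA (A * v)) (norm_nonneg _))
  rw [Matrix.frobenius_norm_conjTranspose] at h2
  rcases (norm_nonneg (A * v)).eq_or_lt with h0 | h0
  · rw [← h0]; positivity
  · nlinarith

/-- `c` is the operator norm and `u` a maximiser. Vectors are one-column matrices, whose Frobenius
norm is the Euclidean one. -/
theorem exists_colBound (A : Matrix m n ℂ) :
    ∃ c : ℝ, 0 ≤ c ∧ (∀ v : Matrix n Unit ℂ, ‖A * v‖ ≤ c * ‖v‖) ∧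
      ∃ u : Matrix n Unit ℂ, ‖u‖ ≤ 1 ∧ ‖A * u‖ = c := by
  have : ProperSpace (Matrix n Unit ℂ) := FiniteDimensional.proper ℂ _
  obtain ⟨u, hu, hmax⟩ := (isCompact_closedBall (0 : Matrix n Unit ℂ) 1).exists_isMaxOn
    ⟨0, by simp⟩ (f := fun v => ‖A * v‖) (by fun_prop)
  refine ⟨‖A * u‖, norm_nonneg _, fun v => ?_, u, by simpa using hu, rfl⟩
  rcases eq_or_ne v 0 with rfl | hv
  · simp
  have hv' : 0 < ‖v‖ := norm_pos_iff.2 hv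
  have h := hmax (a := ((‖v‖⁻¹ : ℝ) : ℂ) • v) (by simp [norm_smul, hv'.ne'])
  simp only [Set.mem_ofPred_eq, Matrix.mul_smul, norm_smul] at h
  rw [Complex.norm_real, norm_inv, norm_norm, inv_mul_le_iff₀ hv'] at h
  linarith

end FrobeniusNorm

/-! ### Singular value decomposition and orthonormal factors. -/

section SingularValueDecomposition

variable {n : Type*} [Fintype n] [DecidableEq n]

/-- The diagonal complex matrix with real diagonal entries `d`. -/
noncomputable def realDiagonal (d : n → ℝ) : Matrix n n ℂ :=
  Matrix.diagonal fun i => (d i : ℂ)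

theorem conjTranspose_realDiagonal {k : Type*} [DecidableEq k] (d : k → ℝ) :
    (realDiagonal d)ᴴ = realDiagonal d := by
  rw [realDiagonal, Matrix.diagonal_conjTranspose]
  congr 1
  ext i
  simp

theorem frobenius_sq_realDiagonal (d : n → ℝ) : ‖realDiagonal d‖ ^ 2 = ∑ i, d i ^ 2 := by
  rw [frobenius_sq_eq_sum]
  refine Finset.sum_congr rfl fun i _ => ?_
  rw [Finset.sum_eq_single i (fun j _ hj => by simp [realDiagonal, Matrix.diagonal_apply_ne' _ hj])
    (by simp)]
  simp [realDiagonal]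

theorem conjTranspose_mul_self_of_orthonormal {m k : Type*} [Fintype m] [DecidableEq k]
    {b : k → EuclideanSpace ℂ m} (hb : Orthonormal ℂ b) :
    (Matrix.of fun r i => b i r)ᴴ * (Matrix.of fun r i => b i r) = (1 : Matrix k k ℂ) := by
  ext i j
  have h := orthonormal_iff_ite.1 hb i j
  rw [PiLp.inner_apply] at h
  simp only [Matrix.mul_apply, Matrix.conjTranspose_apply, Matrix.of_apply, Matrix.one_apply, ← h]
  refine Finset.sum_congr rfl fun r _ => ?_
  simp [mul_comm]

/-- For an eigenbasis V of AᴴA, the columns of AV are orthogonal; the nonzero ones, normalised,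
extend to an orthonormal basis U. -/
theorem exists_eq_mul_realDiagonal (A : Matrix n n ℂ) :
    ∃ (U V : Matrix n n ℂ) (y : n → ℝ), Uᴴ * U = 1 ∧ Vᴴ * V = 1 ∧
      A = U * realDiagonal y * Vᴴ := by
  have hA := Matrix.isHermitian_conjTranspose_mul_self A
  set V : Matrix n n ℂ := ↑hA.eigenvectorUnitary with hVdef
  have hV : Vᴴ * V = 1 := by
    have := hA.eigenvectorUnitary.2
    rw [Matrix.mem_unitaryGroup_iff'] at this
    exact this
  have hV' : V * Vᴴ = 1 := mul_eq_one_comm.1 hV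
  set B := A * V with hB
  have hBB : Bᴴ * B = realDiagonal hA.eigenvalues := by
    have h := hA.conjStarAlgAut_star_eigenvectorUnitary
    rw [Unitary.conjStarAlgAut_star_apply] at h
    rw [hB, Matrix.conjTranspose_mul]
    simp only [Matrix.mul_assoc] at h ⊢
    exact h
  have hent : ∀ i j, ∑ r, star (B r i) * B r j = if i = j then (hA.eigenvalues i : ℂ) else 0 := by
    intro i j
    have h := congrFun (congrFun hBB i) j
    simpa [Matrix.mul_apply, realDiagonal, Matrix.diagonal_apply] using h
  have hnorm : ∀ i, ∑ r, ‖B r i‖ ^ 2 = hA.eigenvalues i := by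
    intro i
    have h := congrArg Complex.re (hent i i)
    simp only [if_true, Complex.re_sum, Complex.ofReal_re] at h
    rw [← h]
    refine Finset.sum_congr rfl fun r _ => ?_
    rw [← Complex.normSq_eq_norm_sq]
    simp [Complex.normSq_apply]
  have hnn : ∀ i, 0 ≤ hA.eigenvalues i := fun i => hnorm i ▸ by positivity
  set y : n → ℝ := fun i => Real.sqrt (hA.eigenvalues i) with hy
  have hyy : ∀ i, y i * y i = hA.eigenvalues i := fun i => Real.mul_self_sqrt (hnn i)
  set v : n → EuclideanSpace ℂ n := fun i => WithLp.toLp 2 fun r => ((y i)⁻¹ : ℂ) * B r i with hv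
  have hon : Orthonormal ℂ (({i | y i ≠ 0} : Set n).domRestrict v) := by
    rw [orthonormal_iff_ite]
    rintro ⟨i, hi⟩ ⟨j, hj⟩
    have hi' : (y i : ℂ) ≠ 0 := by exact_mod_cast hi
    have : inner ℂ (v i) (v j) = ((y i)⁻¹ : ℂ) * (y j)⁻¹ * ∑ r, star (B r i) * B r j := by
      rw [PiLp.inner_apply, Finset.mul_sum]
      refine Finset.sum_congr rfl fun r _ => ?_
      simp [hv]
      ring
    simp only [Set.domRestrict_apply, this, hent, Subtype.mk.injEq]
    split_ifs with hij
    · subst hij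
      rw [← hyy]
      push_cast
      field_simp
    · simp
  obtain ⟨b, hb⟩ := hon.exists_orthonormalBasis_extension_of_card_eq (by simp)
  refine ⟨Matrix.of fun r i => b i r, V, y,
    conjTranspose_mul_self_of_orthonormal b.orthonormal, hV, ?_⟩
  have hUB : (Matrix.of fun r i => b i r) * realDiagonal y = B := by
    ext r i
    rw [realDiagonal, Matrix.mul_diagonal, Matrix.of_apply]
    by_cases hi : y i = 0
    · have h0 : ∑ r, ‖B r i‖ ^ 2 = 0 := by rw [hnorm, ← hyy, hi, mul_zero]
      rw [Finset.sum_eq_zero_iff_of_nonneg (fun _ _ => by positivity)] at h0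
      have := h0 r (Finset.mem_univ r)
      simp_all
    · have hi' : (y i : ℂ) ≠ 0 := by exact_mod_cast hi
      rw [hb i hi]
      simp only [hv]
      field_simp
  rw [hUB, hB, Matrix.mul_assoc, hV', Matrix.mul_one]

theorem conjTranspose_mul_submatrix {U : Matrix n n ℂ} (hU : Uᴴ * U = 1) (π : Equiv.Perm n) :
    (U.submatrix id π)ᴴ * U.submatrix id π = 1 := by
  rw [Matrix.conjTranspose_submatrix, ← Matrix.submatrix_mul _ _ _ _ _ Function.bijective_id, hU,
    Matrix.submatrix_one_equiv]

end SingularValueDecomposition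

/-- A is a permutation matrix and B the same one carrying the signs of `d`. -/
theorem realDiagonal_eq_sorted {L : ℕ} (d : Fin L → ℝ) :
    ∃ (π : Equiv.Perm (Fin L)) (A B : Matrix (Fin L) (Fin L) ℂ), Aᴴ * A = 1 ∧ Bᴴ * B = 1 ∧
      Antitone (fun i => |d (π i)|) ∧
      realDiagonal d = A * realDiagonal (fun i => |d (π i)|) * Bᴴ := by
  set π := Tuple.sort fun i => -|d i|
  have hπ : Antitone (fun i => |d (π i)|) := fun i j hij => by
    have := Tuple.monotone_sort (fun i => -|d i|) hij
    simp only [Function.comp_apply] at this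
    linarith
  -- The sign of 0 is taken to be 1, so that `realDiagonal s` is unitary.
  set s : Fin L → ℝ := fun i => if 0 ≤ d i then 1 else -1 with hs
  have hsd : ∀ i, |d i| * s i = d i := by
    intro i
    by_cases h : 0 ≤ d i
    · simp [hs, h, abs_of_nonneg h]
    · simp [hs, h, abs_of_neg (not_le.1 h)]
  have hS : (realDiagonal s)ᴴ * realDiagonal s = 1 := by
    rw [conjTranspose_realDiagonal, realDiagonal, Matrix.diagonal_mul_diagonal,
      ← Matrix.diagonal_one]
    congr 1
    ext i
    simp only [hs]
    split_ifs <;> simp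
  refine ⟨π, (1 : Matrix _ _ ℂ).submatrix id π, (realDiagonal s).submatrix id π,
    conjTranspose_mul_submatrix (by simp) π, conjTranspose_mul_submatrix hS π, hπ, ?_⟩
  have h1 : realDiagonal (fun i => |d (π i)|) = (realDiagonal fun i => |d i|).submatrix π π := by
    rw [realDiagonal, realDiagonal, Matrix.submatrix_diagonal_equiv]
    rfl
  rw [h1, Matrix.conjTranspose_submatrix, conjTranspose_realDiagonal]
  rw [← Matrix.submatrix_mul _ _ _ _ _ π.bijective, ← Matrix.submatrix_mul _ _ _ _ _ π.bijective,
    Matrix.one_mul, Matrix.submatrix_id_id, realDiagonal, realDiagonal, realDiagonal,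
    Matrix.diagonal_mul_diagonal]
  congr 1
  ext i
  rw [← Complex.ofReal_mul, hsd]

/-- Singular value decomposition of a square complex matrix. -/
theorem exists_svd {L : ℕ} (A : Matrix (Fin L) (Fin L) ℂ) :
    ∃ (U V : Matrix (Fin L) (Fin L) ℂ) (y : Fin L → ℝ), Uᴴ * U = 1 ∧ Vᴴ * V = 1 ∧
      (∀ i, 0 ≤ y i) ∧ Antitone y ∧ A = U * realDiagonal y * Vᴴ := by
  obtain ⟨U, V, y, hU, hV, hA⟩ := exists_eq_mul_realDiagonal A
  obtain ⟨π, C, D, hC, hD, hanti, hy⟩ := realDiagonal_eq_sorted y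
  refine ⟨U * C, V * D, _, ?_, ?_, fun i => abs_nonneg (y (π i)), hanti, ?_⟩
  · rw [Matrix.conjTranspose_mul, Matrix.mul_assoc, ← Matrix.mul_assoc Uᴴ, hU, Matrix.one_mul, hC]
  · rw [Matrix.conjTranspose_mul, Matrix.mul_assoc, ← Matrix.mul_assoc Vᴴ, hV, Matrix.one_mul, hD]
  · rw [hA, hy, Matrix.conjTranspose_mul]
    simp only [Matrix.mul_assoc]

/-- A matrix with at most as many columns as rows factors through an isometry. -/
theorem exists_isometry_mul {N L : ℕ} (h : L ≤ N) (F : Matrix (Fin N) (Fin L) ℂ) :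
    ∃ (Q : Matrix (Fin N) (Fin L) ℂ) (R : Matrix (Fin L) (Fin L) ℂ), Qᴴ * Q = 1 ∧ F = Q * R := by
  -- Zero columns pad F to a square, and the Gram–Schmidt basis completes itself when F is rank
  -- deficient. Triangularity puts the columns of F in the span of the first L basis vectors.
  set f : Fin N → EuclideanSpace ℂ (Fin N) := fun j =>
    WithLp.toLp 2 fun r => if hj : j.val < L then F r ⟨j, hj⟩ else 0 with hf
  set b := InnerProductSpace.gramSchmidtOrthonormalBasis (𝕜 := ℂ) (by simp) f
  set B : Matrix (Fin N) (Fin N) ℂ := Matrix.of fun r i => b i r with hB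
  have hBB : Bᴴ * B = 1 := conjTranspose_mul_self_of_orthonormal b.orthonormal
  have hBB' : B * Bᴴ = 1 := mul_eq_one_comm.1 hBB
  have hzero : ∀ (i : Fin N) (l : Fin L), L ≤ i.val → (Bᴴ * F) i l = 0 := by
    intro i l hi
    have h0 := InnerProductSpace.gramSchmidtOrthonormalBasis_inv_triangular (𝕜 := ℂ) (by simp) f
      (i := Fin.castLE h l) (j := i) (Fin.lt_def.2 (by simp; omega))
    rw [PiLp.inner_apply] at h0
    rw [Matrix.mul_apply, ← h0]
    refine Finset.sum_congr rfl fun r _ => ?_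
    simp [hf, hB, b, mul_comm]
  refine ⟨Matrix.of fun r i => b (Fin.castLE h i) r,
    (Matrix.of fun r i => b (Fin.castLE h i) r)ᴴ * F,
    conjTranspose_mul_self_of_orthonormal (b.orthonormal.comp _ (Fin.castLE_injective h)), ?_⟩
  have hF : F = B * (Bᴴ * F) := by rw [← Matrix.mul_assoc, hBB', Matrix.one_mul]
  ext r l
  conv_lhs => rw [hF]
  rw [Matrix.mul_apply, Matrix.mul_apply]
  symm
  refine Fintype.sum_of_injective (Fin.castLE h) (Fin.castLE_injective h) _ _ ?_ ?_
  · intro i hi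
    rw [hzero i l, mul_zero]
    by_contra! hlt
    exact hi ⟨⟨i, hlt⟩, rfl⟩
  · intro i
    rfl

/-! ### Courant–Fischer bounds for singular values. -/

theorem norm_realDiagonal_mul_col {L : ℕ} (d : Fin L → ℝ) (v : Matrix (Fin L) Unit ℂ) :
    ‖realDiagonal d * v‖ ^ 2 = ∑ i, d i ^ 2 * ‖v i ()‖ ^ 2 := by
  rw [frobenius_sq_eq_sum]
  simp [realDiagonal, Matrix.diagonal_mul, mul_pow]

theorem norm_realDiagonal_mul_col_le {L : ℕ} {d : Fin L → ℝ} (hd : ∀ i, 0 ≤ d i)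
    (hd' : Antitone d) (i : Fin L) (w : Matrix (Fin L) Unit ℂ)
    (hw : ∀ j : Fin L, j.val < i.val → w j () = 0) : ‖realDiagonal d * w‖ ≤ d i * ‖w‖ := by
  rw [← sq_le_sq₀ (norm_nonneg _) (mul_nonneg (hd i) (norm_nonneg _)), mul_pow,
    norm_realDiagonal_mul_col, frobenius_sq_eq_sum, Finset.mul_sum]
  refine Finset.sum_le_sum fun j _ => ?_
  rw [Finset.univ_unique, Finset.sum_singleton]
  rcases lt_or_ge j.val i.val with h | h
  · have := hw j h
    rw [show (default : Unit) = () from rfl, this]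
    simp
  · have h1 := hd' (Fin.le_def.2 h)
    have := hd j
    exact mul_le_mul_of_nonneg_right (by gcongr) (by positivity)

theorem norm_rectDiag_mul_col_le {M N : ℕ} {d : Fin (min M N) → ℝ} (hd : ∀ i, 0 ≤ d i)
    (hd' : Antitone d) (i : Fin (min M N)) (w : Matrix (Fin N) Unit ℂ)
    (hw : ∀ j : Fin N, j.val < i.val → w j () = 0) : ‖rectDiag M N d * w‖ ≤ d i * ‖w‖ := by
  rw [← sq_le_sq₀ (norm_nonneg _) (mul_nonneg (hd i) (norm_nonneg _)), mul_pow,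
    frobenius_sq_eq_sum, frobenius_sq_eq_sum]
  simp only [Finset.univ_unique, Finset.sum_singleton, Matrix.mul_apply]
  have hrow : ∀ r : Fin M, ‖∑ j, rectDiag M N d r j * w j ()‖ ^ 2 ≤
      ∑ j : Fin N, if r.val = j.val then d i ^ 2 * ‖w j ()‖ ^ 2 else 0 := by
    intro r
    by_cases hr : r.val < N
    · rw [Finset.sum_eq_single ⟨r, hr⟩, Finset.sum_eq_single ⟨r, hr⟩]
      · have hr' : r.val < min M N := lt_min r.2 hr
        simp only [rectDiag, Matrix.of_apply, hr', and_self, dite_true, if_true, norm_mul, mul_pow]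
        rw [Complex.norm_real, Real.norm_eq_abs, sq_abs]
        rcases lt_or_ge r.val i.val with h | h
        · rw [hw ⟨r, hr⟩ h]; simp
        · have h1 := hd' (show i ≤ ⟨r, hr'⟩ from h)
          have := hd ⟨r, hr'⟩
          exact mul_le_mul_of_nonneg_right (by gcongr) (by positivity)
      · intro j _ hj
        rw [if_neg fun h => hj (Fin.ext h.symm)]
      · simp
      · intro j _ hj
        have : ¬ (r.val = j.val ∧ r.val < min M N) := fun h => hj (Fin.ext h.1.symm)
        rw [rectDiag, Matrix.of_apply, dif_neg this, zero_mul]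
      · simp
    · have : ∀ j : Fin N, ¬ (r.val = j.val ∧ r.val < min M N) := fun j h => hr (h.1 ▸ j.2)
      simp only [rectDiag, Matrix.of_apply, this, dite_false, zero_mul, Finset.sum_const_zero,
        norm_zero]
      exact (zero_pow two_ne_zero).trans_le
        (Finset.sum_nonneg fun j _ => by split_ifs <;> positivity)
  calc ∑ r, ‖∑ j, rectDiag M N d r j * w j ()‖ ^ 2
      ≤ ∑ r : Fin M, ∑ j : Fin N, if r.val = j.val then d i ^ 2 * ‖w j ()‖ ^ 2 else 0 :=
        Finset.sum_le_sum fun r _ => hrow r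
    _ = ∑ j : Fin N, ∑ r : Fin M, if r.val = j.val then d i ^ 2 * ‖w j ()‖ ^ 2 else 0 :=
        Finset.sum_comm
    _ ≤ ∑ j : Fin N, d i ^ 2 * ‖w j ()‖ ^ 2 := by
        refine Finset.sum_le_sum fun j _ => ?_
        by_cases hj : j.val < M
        · rw [Finset.sum_eq_single ⟨j, hj⟩]
          · simp
          · intro r _ hr
            rw [if_neg fun h => hr (Fin.ext h)]
          · simp
        · rw [Finset.sum_eq_zero]
          · positivity
          · intro r _
            rw [if_neg fun h => hj (by omega)]
    _ = d i ^ 2 * ∑ j : Fin N, ‖w j ()‖ ^ 2 := by rw [Finset.mul_sum]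

/-- Dimension count: i + 1 free coordinates against i linear conditions. -/
theorem exists_col_supported_and_vanishing {L N : ℕ} (D : Matrix (Fin N) (Fin L) ℂ) (i : Fin L) :
    ∃ v : Matrix (Fin L) Unit ℂ, v ≠ 0 ∧ (∀ j, i < j → v j () = 0) ∧
      ∀ j : Fin N, j.val < i.val → (D * v) j () = 0 := by
  set T : (Fin (i.val + 1) → ℂ) →ₗ[ℂ] (Fin i.val → ℂ) :=
    Matrix.mulVecLin (Matrix.of fun (a : Fin i.val) (b : Fin (i.val + 1)) =>
      if h : a.val < N then D ⟨a, h⟩ ⟨b, by omega⟩ else 0) with hT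
  obtain ⟨u, hu, hu0⟩ := (Submodule.ne_bot_iff _).1
    (LinearMap.ker_ne_bot_of_finrank_lt (f := T) (by simp))
  have hi : i.val + 1 ≤ L := i.2
  refine ⟨Matrix.of fun j _ => if h : j.val < i.val + 1 then u ⟨j, h⟩ else 0, ?_, ?_, ?_⟩
  · intro h
    apply hu0
    ext b
    have := congrFun (congrFun h (Fin.castLE hi b)) ()
    rw [Matrix.of_apply, dif_pos (show (Fin.castLE hi b).val < i.val + 1 from b.2)] at this
    exact this
  · intro j hj
    rw [Matrix.of_apply, dif_neg (show ¬ j.val < i.val + 1 by rw [Fin.lt_def] at hj; omega)]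
  · intro j hj
    have h := congrFun (LinearMap.mem_ker.1 hu) ⟨j, hj⟩
    rw [hT] at h
    simp only [Matrix.mulVecLin_apply, Matrix.mulVec, dotProduct, Matrix.of_apply, j.2, dite_true,
      Pi.zero_apply] at h
    rw [Matrix.mul_apply]
    refine Eq.trans (Eq.symm ?_) h
    refine Fintype.sum_of_injective (Fin.castLE hi) (Fin.castLE_injective hi) _ _ ?_ ?_
    · intro b hb
      have : ¬ b.val < i.val + 1 := fun h => hb ⟨⟨b, h⟩, rfl⟩
      rw [Matrix.of_apply, dif_neg this, mul_zero]
    · intro b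
      rw [Matrix.of_apply, dif_pos (show (Fin.castLE hi b).val < i.val + 1 from b.2)]
      rfl

/-- Singular values do not increase, up to the factor `c`, under multiplication by a contraction
on the left and by a matrix of operator norm at most `c` on the right. -/
theorem le_mul_of_mul_mul_eq_realDiagonal {L M N : ℕ} {C : Matrix (Fin L) (Fin M) ℂ}
    {T : Matrix (Fin M) (Fin N) ℂ} {D : Matrix (Fin N) (Fin L) ℂ} {k : Fin L → ℝ} {c t : ℝ}
    (hC : ∀ w : Matrix (Fin M) Unit ℂ, ‖C * w‖ ≤ ‖w‖)
    (hD : ∀ v : Matrix (Fin L) Unit ℂ, ‖D * v‖ ≤ c * ‖v‖) (hk : ∀ i, 0 ≤ k i) (hk' : Antitone k)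
    (h : C * T * D = realDiagonal k) (i : Fin L) (ht : 0 ≤ t)
    (hT : ∀ w : Matrix (Fin N) Unit ℂ, (∀ j : Fin N, j.val < i.val → w j () = 0) →
      ‖T * w‖ ≤ t * ‖w‖) : k i ≤ t * c := by
  -- The test vector: supported where diag(k) stretches by at least `k i`, with image under D where
  -- T stretches by at most `t`.
  obtain ⟨v, hv0, hv, hDv⟩ := exists_col_supported_and_vanishing D i
  have h1 : ‖realDiagonal k * v‖ ≤ t * (c * ‖v‖) := by
    rw [← h, Matrix.mul_assoc, Matrix.mul_assoc]
    exact (hC _).trans ((hT _ hDv).trans (mul_le_mul_of_nonneg_left (hD v) ht))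
  have h2 : k i * ‖v‖ ≤ ‖realDiagonal k * v‖ := by
    rw [← sq_le_sq₀ (mul_nonneg (hk i) (norm_nonneg _)) (norm_nonneg _), mul_pow,
      norm_realDiagonal_mul_col, frobenius_sq_eq_sum, Finset.mul_sum]
    refine Finset.sum_le_sum fun j _ => ?_
    rw [Finset.univ_unique, Finset.sum_singleton]
    rcases lt_or_ge i j with hj | hj
    · rw [show (default : Unit) = () from rfl, hv j hj]
      simp
    · have h3 := hk' hj
      have := hk i
      exact mul_le_mul_of_nonneg_right (by gcongr) (by positivity)
  have hvpos : 0 < ‖v‖ := norm_pos_iff.2 hv0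
  exact le_of_mul_le_mul_right (by linarith) hvpos

/-! ### Doubly stochastic weights and rearrangement. -/

/-- By Birkhoff's theorem D is a convex combination of permutations, for each of which this is the
rearrangement inequality. -/
theorem sum_mul_le_sum_doublyStochastic {n : Type*} [Fintype n] [DecidableEq n]
    {D : Matrix n n ℝ} (hD : D ∈ doublyStochastic ℝ n) {p q : n → ℝ} (hpq : Antivary p q) :
    ∑ i, p i * q i ≤ ∑ i, ∑ j, D i j * (p j * q i) := by
  obtain ⟨w, hw0, hw1, hw⟩ := exists_eq_sum_perm_of_mem_doublyStochastic hD
  have h1 : ∀ σ : Equiv.Perm n, ∑ i, ∑ j, σ.permMatrix ℝ i j * (p j * q i) =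
      ∑ i, p (σ i) * q i := by
    intro σ
    refine Finset.sum_congr rfl fun i _ => ?_
    rw [Finset.sum_eq_single (σ i)]
    · simp [Equiv.Perm.permMatrix, PEquiv.toMatrix_apply]
    · intro j _ hj
      simp [Equiv.Perm.permMatrix, PEquiv.toMatrix_apply, hj.symm]
    · simp
  have h2 : ∑ i, ∑ j, D i j * (p j * q i) = ∑ σ, w σ * ∑ i, p (σ i) * q i := by
    simp_rw [← h1, Finset.mul_sum]
    rw [Finset.sum_comm]
    rw [Finset.sum_comm (s := (Finset.univ : Finset (Equiv.Perm n)))]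
    rw [Finset.sum_comm]
    refine Finset.sum_congr rfl fun i _ => ?_
    rw [Finset.sum_comm]
    refine Finset.sum_congr rfl fun j _ => ?_
    rw [← hw, Matrix.sum_apply, Finset.sum_mul]
    refine Finset.sum_congr rfl fun σ _ => ?_
    rw [Matrix.smul_apply, smul_eq_mul, mul_assoc]
  rw [h2]
  calc ∑ i, p i * q i = ∑ σ, w σ * ∑ i, p i * q i := by rw [← Finset.sum_mul, hw1, one_mul]
    _ ≤ _ := Finset.sum_le_sum fun σ _ => mul_le_mul_of_nonneg_left
        (by simpa using hpq.sum_smul_le_sum_comp_perm_smul (σ := σ)) (hw0 σ)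

theorem normSq_entries_mem_doublyStochastic {n : Type*} [Fintype n] [DecidableEq n]
    {C : Matrix n n ℂ} (hC : Cᴴ * C = 1) :
    (Matrix.of fun i j => ‖C j i‖ ^ 2) ∈ doublyStochastic ℝ n := by
  have hC' : C * Cᴴ = 1 := mul_eq_one_comm.1 hC
  rw [mem_doublyStochastic_iff_sum]
  refine ⟨fun i j => by simp, fun i => ?_, fun j => ?_⟩
  · have h := congrArg Complex.re (congrFun (congrFun hC i) i)
    simp only [Matrix.mul_apply, Matrix.one_apply_eq, Complex.re_sum, Complex.one_re] at h
    rw [← h]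
    refine Finset.sum_congr rfl fun r _ => ?_
    rw [Matrix.of_apply, ← Complex.normSq_eq_norm_sq]
    simp [Complex.normSq_apply]
  · have h := congrArg Complex.re (congrFun (congrFun hC' j) j)
    simp only [Matrix.mul_apply, Matrix.one_apply_eq, Complex.re_sum, Complex.one_re] at h
    rw [← h]
    refine Finset.sum_congr rfl fun r _ => ?_
    rw [Matrix.of_apply, ← Complex.normSq_eq_norm_sq]
    simp [Complex.normSq_apply]

/-- Entrywise |x_i D_ij| = |C_ji| k_j, so ‖D‖² is bounded below by the sum of k_j² / x_i² with
doubly stochastic weights |C_ji|²; k² and x⁻² are oppositely ordered. -/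
theorem sum_sq_div_le_frobenius_sq {L : ℕ} {C D : Matrix (Fin L) (Fin L) ℂ} {k x : Fin L → ℝ}
    (hC : Cᴴ * C = 1) (hk : ∀ i, 0 ≤ k i) (hk' : Antitone k) (hx : ∀ i, 0 ≤ x i)
    (hx' : Antitone x) (h : C * realDiagonal x * D = realDiagonal k) :
    ∑ i, (k i / x i) ^ 2 ≤ ‖D‖ ^ 2 := by
  have hent : ∀ i j, ‖C j i‖ ^ 2 * k j ^ 2 = x i ^ 2 * ‖D i j‖ ^ 2 := by
    intro i j
    have h1 : realDiagonal x * D = Cᴴ * realDiagonal k := by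
      rw [← h, Matrix.mul_assoc C, ← Matrix.mul_assoc Cᴴ, hC, Matrix.one_mul]
    have h2 := congrArg (fun z => ‖z‖ ^ 2) (congrFun (congrFun h1 i) j)
    simp only [realDiagonal, Matrix.diagonal_mul, Matrix.mul_diagonal, norm_mul, mul_pow,
      Complex.norm_real, Real.norm_eq_abs, sq_abs, Matrix.conjTranspose_apply, norm_star] at h2
    exact h2.symm
  obtain ⟨K, hK⟩ : ∃ K, ∀ i, (x i)⁻¹ ^ 2 ≤ K := by
    obtain ⟨K, hK⟩ := (Set.finite_range fun i => (x i)⁻¹ ^ 2).bddAbove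
    exact ⟨K, fun i => hK ⟨i, rfl⟩⟩
  -- Where `x i = 0` the weight 1/x² becomes the upper bound K, keeping `q` monotone; by `hent` the
  -- corresponding terms of the weighted sum vanish.
  set q : Fin L → ℝ := fun i => if x i = 0 then K else (x i)⁻¹ ^ 2 with hq
  have hqmono : Monotone q := by
    intro i j hij
    simp only [hq]
    split_ifs with h1 h2 h2
    · exact le_rfl
    · exact absurd (le_antisymm (h1 ▸ hx' hij) (hx j)) h2
    · exact hK i
    · have hj : 0 < x j := (hx j).lt_of_ne' h2
      have := hx' hij
      have hi := hx i
      gcongr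
  have hanti : Antivary (fun i => k i ^ 2) q := by
    refine Antitone.antivary ?_ hqmono
    intro i j hij
    have h1 := hk' hij
    have := hk j
    simp only
    gcongr
  have hle := sum_mul_le_sum_doublyStochastic (normSq_entries_mem_doublyStochastic hC) hanti
  have hq0 : ∀ i, 0 ≤ q i := by
    intro i
    simp only [hq]
    split_ifs
    · exact le_trans (by positivity) (hK i)
    · positivity
  calc ∑ i, (k i / x i) ^ 2 ≤ ∑ i, k i ^ 2 * q i := by
        refine Finset.sum_le_sum fun i _ => ?_
        by_cases h0 : x i = 0
        · rw [h0, div_zero, zero_pow two_ne_zero]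
          exact mul_nonneg (by positivity) (hq0 i)
        · simp only [hq, h0, if_false]
          rw [div_eq_mul_inv, mul_pow]
    _ ≤ _ := hle
    _ ≤ ‖D‖ ^ 2 := by
        rw [frobenius_sq_eq_sum]
        refine Finset.sum_le_sum fun i _ => Finset.sum_le_sum fun j _ => ?_
        rw [Matrix.of_apply, ← mul_assoc, hent]
        by_cases h0 : x i = 0
        · rw [h0]
          simp
        · simp only [hq, h0, if_false]
          rw [mul_right_comm, ← mul_pow, mul_inv_cancel₀ h0, one_pow, one_mul]

/-! ### Domination of a matrix pair by scalar gains. -/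

theorem conjTranspose_mul_isometry {m n p : Type*} [Fintype m] [Fintype n] [Fintype p]
    [DecidableEq n] [DecidableEq p] {A : Matrix m n ℂ} {B : Matrix n p ℂ} (hA : Aᴴ * A = 1)
    (hB : Bᴴ * B = 1) : (A * B)ᴴ * (A * B) = 1 := by
  rw [Matrix.conjTranspose_mul, Matrix.mul_assoc, ← Matrix.mul_assoc Aᴴ, hA, Matrix.one_mul, hB]

theorem exists_svd_realDiagonal_mul {L : ℕ} {F : Matrix (Fin L) (Fin L) ℂ} {x : Fin L → ℝ} {c : ℝ}
    (hx : ∀ i, 0 ≤ x i) (hx' : Antitone x)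
    (hF : ∀ v : Matrix (Fin L) Unit ℂ, ‖F * v‖ ≤ c * ‖v‖) :
    ∃ (U V : Matrix (Fin L) (Fin L) ℂ) (y : Fin L → ℝ), Uᴴ * U = 1 ∧ Vᴴ * V = 1 ∧
      (∀ i, 0 ≤ y i) ∧ Antitone y ∧ realDiagonal x * F = U * realDiagonal y * Vᴴ ∧
      (∀ i, y i ≤ x i * c) ∧ ∑ i, (y i / x i) ^ 2 ≤ ‖F‖ ^ 2 := by
  obtain ⟨U, V, y, hU, hV, hy, hy', h⟩ := exists_svd (realDiagonal x * F)
  have hU' : U * Uᴴ = 1 := mul_eq_one_comm.1 hU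
  have hV' : V * Vᴴ = 1 := mul_eq_one_comm.1 hV
  have hD : Uᴴ * realDiagonal x * (F * V) = realDiagonal y := by
    rw [Matrix.mul_assoc, ← Matrix.mul_assoc (realDiagonal x), h]
    simp only [Matrix.mul_assoc, hV, Matrix.mul_one]
    rw [← Matrix.mul_assoc, hU, Matrix.one_mul]
  refine ⟨U, V, y, hU, hV, hy, hy', h, fun i => ?_, ?_⟩
  · refine le_mul_of_mul_mul_eq_realDiagonal (frobenius_norm_coisometry_mul_le hU) (fun v => ?_)
      hy hy' hD i (hx i) (norm_realDiagonal_mul_col_le hx hx' i)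
    rw [Matrix.mul_assoc, ← frobenius_norm_isometry_mul hV v]
    exact hF _
  · have h1 := sum_sq_div_le_frobenius_sq (C := Uᴴ) (by simpa using hU') hy hy' hx hx' hD
    rwa [← frobenius_norm_mul_coisometry (W := Vᴴ) (by simpa using hV') F,
      Matrix.conjTranspose_conjTranspose]

/-- Unitary invariance replaces 1 by Q = UᴴV. Row i then contributes b_i² - 2 b_i Re Q_ii + 1, and
Re Q_ii ≤ 1. -/
theorem sum_sq_sub_one_le_of_svd {L : ℕ} {U V : Matrix (Fin L) (Fin L) ℂ} {b : Fin L → ℝ}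
    (hU : Uᴴ * U = 1) (hV : Vᴴ * V = 1) (hb : ∀ i, 0 ≤ b i) :
    ∑ i, (b i - 1) ^ 2 ≤ ‖U * realDiagonal b * Vᴴ - 1‖ ^ 2 := by
  have hU' : U * Uᴴ = 1 := mul_eq_one_comm.1 hU
  set Q := Uᴴ * V with hQdef
  have hQ : Qᴴ * Q = 1 := conjTranspose_mul_isometry (by simpa using hU') hV
  have hV' : V * Vᴴ = 1 := mul_eq_one_comm.1 hV
  have hQd := normSq_entries_mem_doublyStochastic hQ
  rw [mem_doublyStochastic_iff_sum] at hQd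
  have hrow : ∀ i, ∑ j, ‖Q i j‖ ^ 2 = 1 := fun i => hQd.2.2 i
  have h1 : U * realDiagonal b * Vᴴ - 1 = U * (realDiagonal b - Q) * Vᴴ := by
    rw [Matrix.mul_sub, Matrix.sub_mul, hQdef, ← Matrix.mul_assoc U, hU', Matrix.one_mul, hV']
  rw [h1, frobenius_norm_mul_coisometry hV, frobenius_norm_isometry_mul hU, frobenius_sq_eq_sum]
  refine Finset.sum_le_sum fun i _ => ?_
  have hent : ∀ j, ‖(realDiagonal b - Q) i j‖ ^ 2 =
      ‖Q i j‖ ^ 2 + if j = i then b i ^ 2 - 2 * b i * (Q i i).re else 0 := by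
    intro j
    split_ifs with hj
    · subst hj
      simp only [realDiagonal, ← Complex.normSq_eq_norm_sq, Complex.normSq_apply,
        Matrix.sub_apply, Matrix.diagonal_apply_eq, Complex.sub_re, Complex.sub_im,
        Complex.ofReal_re, Complex.ofReal_im]
      ring
    · simp [realDiagonal, Matrix.diagonal_apply_ne' _ hj]
  simp only [hent, Finset.sum_add_distrib, hrow]
  rw [Finset.sum_ite_eq' Finset.univ i, if_pos (Finset.mem_univ i)]
  have h2 : ‖Q i i‖ ^ 2 ≤ 1 := by
    rw [← hrow i]
    exact Finset.single_le_sum (f := fun j => ‖Q i j‖ ^ 2) (fun _ _ => by positivity)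
      (Finset.mem_univ i)
  have h3 : (Q i i).re ≤ 1 :=
    (Complex.re_le_norm _).trans ((sq_le_one_iff₀ (norm_nonneg _)).1 h2)
  nlinarith [hb i]

/-- Any precoder-equalizer pair for a diagonal channel is dominated by parallel scalar gains. -/
theorem exists_gains_le_of_antitone {L : ℕ} {F G : Matrix (Fin L) (Fin L) ℂ} {x : Fin L → ℝ}
    {c c' : ℝ} (hx : ∀ i, 0 ≤ x i) (hx' : Antitone x) (hc : 0 ≤ c) (hc' : 0 ≤ c')
    (hF : ∀ v : Matrix (Fin L) Unit ℂ, ‖F * v‖ ≤ c * ‖v‖)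
    (hG : ∀ v : Matrix (Fin L) Unit ℂ, ‖Gᴴ * v‖ ≤ c' * ‖v‖) :
    ∃ a : Fin L → ℝ, (∀ i, 0 ≤ a i) ∧ (∀ i, a i ≤ c * c') ∧ ∑ i, a i ≤ ‖F‖ * ‖G‖ ∧
      ∑ i, (a i * x i - 1) ^ 2 ≤ ‖G * realDiagonal x * F - 1‖ ^ 2 := by
  -- F is absorbed into the diagonal channel, then G: x becomes y, then b. The ratios y/x and b/y
  -- are the effective scalar gains of F and G; Cauchy–Schwarz bounds the sum of their products.
  obtain ⟨U, V, y, hU, hV, hy, hy', h, hyc, hys⟩ := exists_svd_realDiagonal_mul hx hx' hF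
  have hU' : U * Uᴴ = 1 := mul_eq_one_comm.1 hU
  have hGU : ∀ v : Matrix (Fin L) Unit ℂ, ‖(G * U)ᴴ * v‖ ≤ c' * ‖v‖ := fun v => by
    rw [Matrix.conjTranspose_mul, Matrix.mul_assoc,
      frobenius_norm_isometry_mul (by simpa using hU')]
    exact hG v
  obtain ⟨S, T, b, hS, hT, hb, -, hbT, hbc, hbs⟩ := exists_svd_realDiagonal_mul hy hy' hGU
  have hGn : ‖(G * U)ᴴ‖ = ‖G‖ := by
    rw [Matrix.conjTranspose_mul, frobenius_norm_isometry_mul (by simpa using hU'),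
      Matrix.frobenius_norm_conjTranspose]
  rw [hGn] at hbs
  have hprod : G * realDiagonal x * F = T * realDiagonal b * (V * S)ᴴ := by
    have h1 := congrArg Matrix.conjTranspose hbT
    simp only [Matrix.conjTranspose_mul, Matrix.conjTranspose_conjTranspose,
      conjTranspose_realDiagonal, Matrix.mul_assoc] at h1
    rw [Matrix.mul_assoc, h, Matrix.conjTranspose_mul]
    calc G * (U * realDiagonal y * Vᴴ) = G * (U * realDiagonal y) * Vᴴ := by
          simp only [Matrix.mul_assoc]
      _ = _ := by rw [h1]; simp only [Matrix.mul_assoc]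
  have hax : ∀ i, y i / x i * (b i / y i) * x i = b i := by
    intro i
    rcases eq_or_ne (y i) 0 with h0 | h0
    · have := hbc i
      rw [h0, zero_mul] at this
      rw [h0, le_antisymm this (hb i)]
      simp
    · have hx0 : x i ≠ 0 := fun hx0 => h0 (le_antisymm (by simpa [hx0] using hyc i) (hy i))
      field_simp
  refine ⟨fun i => y i / x i * (b i / y i), fun i => ?_, fun i => ?_, ?_, ?_⟩
  · exact mul_nonneg (div_nonneg (hy i) (hx i)) (div_nonneg (hb i) (hy i))
  · refine mul_le_mul ?_ ?_ (div_nonneg (hb i) (hy i)) hc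
    · exact div_le_of_le_mul₀ (hx i) hc (by linarith [hyc i])
    · exact div_le_of_le_mul₀ (hy i) hc' (by linarith [hbc i])
  · refine abs_le_of_sq_le_sq' ?_ (by positivity) |>.2
    rw [mul_pow]
    exact (Finset.sum_mul_sq_le_sq_mul_sq _ _ _).trans
      (mul_le_mul hys hbs (by positivity) (by positivity))
  · simp only [hax]
    rw [hprod]
    exact sum_sq_sub_one_le_of_svd hT (conjTranspose_mul_isometry hV hS) hb

theorem exists_gains_le {L : ℕ} {F G : Matrix (Fin L) (Fin L) ℂ} (h : Fin L → ℝ)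
    {c c' : ℝ} (hc : 0 ≤ c) (hc' : 0 ≤ c')
    (hF : ∀ v : Matrix (Fin L) Unit ℂ, ‖F * v‖ ≤ c * ‖v‖)
    (hG : ∀ v : Matrix (Fin L) Unit ℂ, ‖Gᴴ * v‖ ≤ c' * ‖v‖) :
    ∃ a : Fin L → ℝ, (∀ i, |a i| ≤ c * c') ∧ ∑ i, |a i| ≤ ‖F‖ * ‖G‖ ∧
      ∑ i, (a i * h i - 1) ^ 2 ≤ ‖G * realDiagonal h * F - 1‖ ^ 2 := by
  obtain ⟨π, A, B, hA, hB, hanti, hd⟩ := realDiagonal_eq_sorted h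
  have hA' : A * Aᴴ = 1 := mul_eq_one_comm.1 hA
  have hB' : B * Bᴴ = 1 := mul_eq_one_comm.1 hB
  have hBF : ∀ v : Matrix (Fin L) Unit ℂ, ‖(Bᴴ * F) * v‖ ≤ c * ‖v‖ := fun v => by
    rw [Matrix.mul_assoc, frobenius_norm_isometry_mul (by simpa using hB')]
    exact hF v
  have hAG : ∀ v : Matrix (Fin L) Unit ℂ, ‖(G * A)ᴴ * v‖ ≤ c' * ‖v‖ := fun v => by
    rw [Matrix.conjTranspose_mul, Matrix.mul_assoc,
      frobenius_norm_isometry_mul (by simpa using hA')]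
    exact hG v
  obtain ⟨a, ha0, hac, has, hax⟩ := exists_gains_le_of_antitone (fun i => abs_nonneg (h (π i)))
    hanti hc hc' hBF hAG
  have hFn : ‖Bᴴ * F‖ = ‖F‖ := frobenius_norm_isometry_mul (by simpa using hB') F
  have hGn : ‖G * A‖ = ‖G‖ := by
    have := frobenius_norm_mul_coisometry (W := Aᴴ) (by simpa using hA') G
    rwa [Matrix.conjTranspose_conjTranspose] at this
  -- Only an inequality, because the gain is dropped when `h i = 0`.
  have habs : ∀ i, |SignType.sign (h i) * a (π.symm i)| ≤ a (π.symm i) := by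
    intro i
    rw [abs_mul, abs_of_nonneg (ha0 _)]
    refine mul_le_of_le_one_left (ha0 _) ?_
    rcases lt_trichotomy (h i) 0 with h0 | h0 | h0 <;> simp [h0]
  refine ⟨fun i => SignType.sign (h i) * a (π.symm i), fun i => (habs i).trans (hac _), ?_, ?_⟩
  · refine (Finset.sum_le_sum fun i _ => habs i).trans ?_
    rw [Equiv.sum_comp π.symm a, ← hFn, ← hGn]
    exact has
  · have h1 : G * A * realDiagonal (fun i => |h (π i)|) * (Bᴴ * F) = G * realDiagonal h * F := by
      rw [hd]
      simp only [Matrix.mul_assoc]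
    rw [h1] at hax
    refine le_trans (le_of_eq ?_) hax
    rw [← Equiv.sum_comp π]
    refine Finset.sum_congr rfl fun i _ => ?_
    simp only [Equiv.symm_apply_apply]
    rw [mul_right_comm, sign_mul_self, mul_comm]

/-! ### Spending the residual error budget along a rank-one direction. -/

/-- For n > 0, n t² + 2 r t = d has one root of each weak sign; take the one with t (n q - l r) ≥ 0.
Then n (2 t q + t² l) = 2 t (n q - l r) + d l ≥ n d l, as n ≤ 1. -/
theorem exists_step_of_sphere {d n r q l : ℝ} (hd : 0 ≤ d) (hn : 0 ≤ n) (hn1 : n ≤ 1)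
    (hl : 0 ≤ l) (hnl : n = 0 → l = 0) :
    ∃ t : ℝ, n * t ^ 2 + 2 * r * t ≤ d ∧ d * l ≤ 2 * t * q + t ^ 2 * l := by
  rcases hn.eq_or_lt with h0 | h0
  · exact ⟨0, by simpa using hd, by simp [hnl h0.symm]⟩
  have hs := Real.sq_sqrt (show 0 ≤ r ^ 2 + n * d by positivity)
  have hs' : |r| ≤ √(r ^ 2 + n * d) := Real.abs_le_sqrt (by nlinarith)
  set s := √(r ^ 2 + n * d)
  have key : ∀ t, n * t = -r + s ∨ n * t = -r - s → 0 ≤ t * (n * q - l * r) →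
      n * t ^ 2 + 2 * r * t ≤ d ∧ d * l ≤ 2 * t * q + t ^ 2 * l := by
    intro t ht hq
    have hroot : n * (n * t ^ 2 + 2 * r * t) = n * d := by
      rcases ht with ht | ht
      · linear_combination (n * t + r + s) * ht + hs
      · linear_combination (n * t + r - s) * ht + hs
    have hroot' := mul_left_cancel₀ h0.ne' hroot
    refine ⟨hroot'.le, ?_⟩
    refine le_of_mul_le_mul_left ?_ h0
    have h1 : n * (2 * t * q + t ^ 2 * l) = 2 * (t * (n * q - l * r)) + d * l := by
      linear_combination l * hroot'
    rw [h1]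
    nlinarith [mul_nonneg hd hl]
  rcases le_total 0 (n * q - l * r) with h1 | h1
  · refine ⟨(-r + s) / n, key _ (Or.inl (by field_simp)) (mul_nonneg (div_nonneg ?_ hn) h1)⟩
    linarith [le_abs_self r]
  · refine ⟨(-r - s) / n, key _ (Or.inr (by field_simp))
      (mul_nonneg_of_nonpos_of_nonpos (div_nonpos_of_nonpos_of_nonneg ?_ hn) h1)⟩
    linarith [neg_abs_le r]

/-- The error moves along u wᴴ, for which G (u wᴴ) F has norm c c'; the quadratic step lemma
supplies its length. -/
theorem exists_error_ge {L : ℕ} {F G K E₀ : Matrix (Fin L) (Fin L) ℂ} {ε c c' : ℝ} (hε : 0 ≤ ε)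
    (hE₀ : ‖E₀‖ ≤ ε) {u w : Matrix (Fin L) Unit ℂ} (hu : ‖u‖ ≤ 1) (hw : ‖w‖ ≤ 1)
    (hFw : ‖Fᴴ * w‖ = c) (hGu : ‖G * u‖ = c') :
    ∃ E, ‖E‖ ≤ ε ∧ ‖G * (K + E₀) * F - 1‖ ^ 2 + (ε ^ 2 - ‖E₀‖ ^ 2) * (c * c') ^ 2 ≤
      ‖G * (K + E) * F - 1‖ ^ 2 := by
  obtain ⟨r, hr⟩ := frobenius_sq_add_smul E₀ (u * wᴴ)
  obtain ⟨q, hq⟩ := frobenius_sq_add_smul (G * (K + E₀) * F - 1) (G * (u * wᴴ) * F)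
  have hl : ‖G * (u * wᴴ) * F‖ = c * c' := by
    have : G * (u * wᴴ) * F = (G * u) * (Fᴴ * w)ᴴ := by
      simp only [Matrix.conjTranspose_mul, Matrix.conjTranspose_conjTranspose, Matrix.mul_assoc]
    rw [this, frobenius_norm_col_mul_row, Matrix.frobenius_norm_conjTranspose, hFw, hGu, mul_comm]
  have hn : ‖u * wᴴ‖ ≤ 1 := by
    rw [frobenius_norm_col_mul_row, Matrix.frobenius_norm_conjTranspose]
    exact mul_le_one₀ hu (norm_nonneg _) hw
  have hd : 0 ≤ ε ^ 2 - ‖E₀‖ ^ 2 := by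
    have := pow_le_pow_left₀ (norm_nonneg _) hE₀ 2
    linarith
  obtain ⟨t, ht1, ht2⟩ := exists_step_of_sphere (r := r) (q := q) hd (sq_nonneg ‖u * wᴴ‖)
    (pow_le_one₀ (norm_nonneg _) hn) (sq_nonneg (c * c')) (fun h => by
      rw [sq_eq_zero_iff, norm_eq_zero] at h
      rw [← hl, h]
      simp)
  refine ⟨E₀ + (t : ℂ) • (u * wᴴ), ?_, ?_⟩
  · rw [← sq_le_sq₀ (norm_nonneg _) hε, hr]
    linarith
  · have : G * (K + (E₀ + (t : ℂ) • (u * wᴴ))) * F - 1 =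
        (G * (K + E₀) * F - 1) + (t : ℂ) • (G * (u * wᴴ) * F) := by
      rw [← add_assoc, Matrix.mul_add, Matrix.add_mul, Matrix.mul_smul, Matrix.smul_mul]
      abel
    rw [this, hq, hl]
    linarith

/-! ### The parallel scalar problem and the minimax argument. -/

/-- The Euclidean ball of radius `ε` in coordinate space. -/
def coordBall (L : ℕ) (ε : ℝ) : Set (Fin L → ℝ) := {x | ∑ i, x i ^ 2 ≤ ε ^ 2}

theorem mem_coordBall {L : ℕ} {ε : ℝ} {x : Fin L → ℝ} :
    x ∈ coordBall L ε ↔ ∑ i, x i ^ 2 ≤ ε ^ 2 := Iff.rfl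

theorem zero_mem_coordBall (L : ℕ) (ε : ℝ) : (0 : Fin L → ℝ) ∈ coordBall L ε := by
  rw [mem_coordBall]
  simpa using sq_nonneg ε

theorem convex_coordBall (L : ℕ) (ε : ℝ) : Convex ℝ (coordBall L ε) := by
  intro x hx y hy p q hp hq hpq
  rw [mem_coordBall] at *
  calc ∑ i, (p • x + q • y) i ^ 2 ≤ ∑ i, (p * x i ^ 2 + q * y i ^ 2) := by
        refine Finset.sum_le_sum fun i _ => ?_
        simp only [Pi.add_apply, Pi.smul_apply, smul_eq_mul]
        obtain rfl : q = 1 - p := by linarith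
        nlinarith [mul_nonneg (mul_nonneg hp hq) (sq_nonneg (x i - y i))]
    _ = p * ∑ i, x i ^ 2 + q * ∑ i, y i ^ 2 := by
        rw [Finset.sum_add_distrib, Finset.mul_sum, Finset.mul_sum]
    _ ≤ p * ε ^ 2 + q * ε ^ 2 := by gcongr
    _ = ε ^ 2 := by rw [← add_mul, hpq, one_mul]

theorem isCompact_coordBall (L : ℕ) (ε : ℝ) : IsCompact (coordBall L ε) := by
  refine (isCompact_Icc (a := fun _ : Fin L => -|ε|) (b := fun _ => |ε|)).of_isClosed_subset
    (isClosed_le (by fun_prop) continuous_const) fun x hx => ?_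
  have h : ∀ i, |x i| ≤ |ε| := fun i => by
    rw [← sq_le_sq]
    exact (Finset.single_le_sum (f := fun j => x j ^ 2) (fun _ _ => sq_nonneg _)
      (Finset.mem_univ i)).trans hx
  exact ⟨fun i => (abs_le.1 (h i)).1, fun i => (abs_le.1 (h i)).2⟩

/-- The mean-square error of parallel scalar channels `γ + x` with gains `a`. -/
def gainError {L : ℕ} (γ a x : Fin L → ℝ) : ℝ := ∑ i, (a i * (γ i + x i) - 1) ^ 2

theorem continuous_gainError {L : ℕ} (γ : Fin L → ℝ) :
    Continuous fun z : (Fin L → ℝ) × (Fin L → ℝ) => gainError γ z.1 z.2 := by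
  unfold gainError
  fun_prop

/-- If every choice of gains has a bad channel error, then there is a single channel error, with a
residual budget spent on the worst direction, that is bad for all bounded gains. -/
theorem exists_saddle_error {L : ℕ} {k : Fin L → ℝ} {ε τ V R : ℝ} (hτ : 0 ≤ τ) (hR : 0 ≤ R)
    (h : ∀ a : Fin L → ℝ, ∃ x ∈ coordBall L ε, V ≤ gainError k a x + τ * (∑ i, |a i|) ^ 2) :
    ∃ x ∈ coordBall L ε, ∀ a : Fin L → ℝ, (∀ i, |a i| ≤ R) →
      V ≤ gainError k a x + (ε ^ 2 - ∑ i, x i ^ 2) * R ^ 2 + τ * (∑ i, |a i|) ^ 2 := by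
  -- The credit makes the coefficient of x_i² equal to a_i² - R² ≤ 0, hence J concave in x. It is
  -- nonnegative on the ball, so `h` still bounds J from below.
  set J : (Fin L → ℝ) → (Fin L → ℝ) → ℝ := fun a x =>
    gainError k a x + (ε ^ 2 - ∑ i, x i ^ 2) * R ^ 2 + τ * (∑ i, |a i|) ^ 2 with hJ
  set X : Set (Fin L → ℝ) := Set.Icc (fun _ => -R) (fun _ => R) with hX
  have hXmem : ∀ a, a ∈ X ↔ ∀ i, |a i| ≤ R := fun a => by
    simp only [hX, Set.mem_Icc, Pi.le_def, abs_le, forall_and]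
  have hconv : ∀ x ∈ coordBall L ε, QuasiconvexOn ℝ X fun a => J a x := by
    intro x _
    refine ConvexOn.quasiconvexOn ⟨convex_Icc _ _, ?_⟩
    intro a _ b _ p q hp hq hpq
    obtain rfl : q = 1 - p := by linarith
    have h1 : gainError k (p • a + (1 - p) • b) x ≤
        p * gainError k a x + (1 - p) * gainError k b x := by
      unfold gainError
      rw [Finset.mul_sum, Finset.mul_sum, ← Finset.sum_add_distrib]
      refine Finset.sum_le_sum fun i _ => ?_
      simp only [Pi.add_apply, Pi.smul_apply, smul_eq_mul]
      nlinarith [mul_nonneg (mul_nonneg hp hq)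
        (sq_nonneg (a i * (k i + x i) - b i * (k i + x i)))]
    have h2 : ∑ i, |(p • a + (1 - p) • b) i| ≤ p * ∑ i, |a i| + (1 - p) * ∑ i, |b i| := by
      rw [Finset.mul_sum, Finset.mul_sum, ← Finset.sum_add_distrib]
      refine Finset.sum_le_sum fun i _ => ?_
      simp only [Pi.add_apply, Pi.smul_apply, smul_eq_mul]
      refine (abs_add_le _ _).trans ?_
      rw [abs_mul, abs_mul, abs_of_nonneg hp, abs_of_nonneg hq]
    have h3 : (∑ i, |(p • a + (1 - p) • b) i|) ^ 2 ≤
        p * (∑ i, |a i|) ^ 2 + (1 - p) * (∑ i, |b i|) ^ 2 := by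
      refine (pow_le_pow_left₀ (by positivity) h2 2).trans ?_
      nlinarith [mul_nonneg (mul_nonneg hp hq) (sq_nonneg (∑ i, |a i| - ∑ i, |b i|))]
    have h4 := mul_le_mul_of_nonneg_left h3 hτ
    simp only [hJ, smul_eq_mul]
    linarith
  have hconc : ∀ a ∈ X, QuasiconcaveOn ℝ (coordBall L ε) fun x => J a x := by
    intro a ha
    rw [hXmem] at ha
    refine ConcaveOn.quasiconcaveOn ⟨convex_coordBall L ε, ?_⟩
    intro x _ y _ p q hp hq hpq
    obtain rfl : q = 1 - p := by linarith
    have h1 : ∀ z : Fin L → ℝ, J a z = ∑ i, ((a i * (k i + z i) - 1) ^ 2 - R ^ 2 * z i ^ 2) +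
        (ε ^ 2 * R ^ 2 + τ * (∑ i, |a i|) ^ 2) := by
      intro z
      rw [Finset.sum_sub_distrib, ← Finset.mul_sum]
      simp only [hJ, gainError]
      ring
    have h2 : p * ∑ i, ((a i * (k i + x i) - 1) ^ 2 - R ^ 2 * x i ^ 2) +
        (1 - p) * ∑ i, ((a i * (k i + y i) - 1) ^ 2 - R ^ 2 * y i ^ 2) ≤
        ∑ i, ((a i * (k i + (p • x + (1 - p) • y) i) - 1) ^ 2 -
          R ^ 2 * (p • x + (1 - p) • y) i ^ 2) := by
      rw [Finset.mul_sum, Finset.mul_sum, ← Finset.sum_add_distrib]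
      refine Finset.sum_le_sum fun i _ => ?_
      simp only [Pi.add_apply, Pi.smul_apply, smul_eq_mul]
      have h3 : 0 ≤ R ^ 2 - a i ^ 2 := by
        have := sq_le_sq.2 ((ha i).trans (le_abs_self R))
        linarith
      have h4 := mul_nonneg (mul_nonneg (mul_nonneg hp hq) h3) (sq_nonneg (x i - y i))
      linarith [show (a i * (k i + (p * x i + (1 - p) * y i)) - 1) ^ 2 -
          R ^ 2 * (p * x i + (1 - p) * y i) ^ 2 -
          (p * ((a i * (k i + x i) - 1) ^ 2 - R ^ 2 * x i ^ 2) +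
            (1 - p) * ((a i * (k i + y i) - 1) ^ 2 - R ^ 2 * y i ^ 2)) =
          p * (1 - p) * (R ^ 2 - a i ^ 2) * (x i - y i) ^ 2 by ring]
    simp only [smul_eq_mul, h1]
    linarith
  have hcx : ∀ x, Continuous fun a => J a x := fun x => by
    simp only [hJ, gainError]
    fun_prop
  have hca : ∀ a, Continuous fun x => J a x := fun a => by
    simp only [hJ, gainError]
    fun_prop
  obtain ⟨a, ha, x, hx, hsad⟩ := Sion.exists_isSaddlePointOn (f := J) (X := X)
    (Y := coordBall L ε) ⟨0, (hXmem 0).2 fun _ => by simpa using hR⟩ (convex_Icc _ _) isCompact_Icc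
    (fun x _ => (hcx x).continuousOn.lowerSemicontinuousOn) hconv (convex_coordBall L ε)
    ⟨0, zero_mem_coordBall L ε⟩ (isCompact_coordBall L ε)
    (fun a _ => (hca a).continuousOn.upperSemicontinuousOn) hconc
  refine ⟨x, hx, fun b hb => ?_⟩
  obtain ⟨y, hy, hV⟩ := h a
  have h1 := hsad b ((hXmem b).2 hb) y hy
  have h2 : 0 ≤ (ε ^ 2 - ∑ i, y i ^ 2) * R ^ 2 :=
    mul_nonneg (sub_nonneg.2 hy) (sq_nonneg R)
  simp only [hJ] at h1
  linarith

/-- With R = c c', the product of operator norms, the credit in the saddle bound is exactly the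
increase that the rank-one move delivers. -/
theorem exists_error_of_forall_gains {L : ℕ} {k : Fin L → ℝ} {ε τ V : ℝ} (hε : 0 ≤ ε) (hτ : 0 ≤ τ)
    (h : ∀ a : Fin L → ℝ, ∃ x ∈ coordBall L ε, V ≤ gainError k a x + τ * (∑ i, |a i|) ^ 2)
    (F G : Matrix (Fin L) (Fin L) ℂ) :
    ∃ E : Matrix (Fin L) (Fin L) ℂ, ‖E‖ ≤ ε ∧
      V ≤ ‖G * (realDiagonal k + E) * F - 1‖ ^ 2 + τ * (‖F‖ * ‖G‖) ^ 2 := by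
  obtain ⟨c, hc, hcF, w, hw, hFw⟩ := exists_colBound Fᴴ
  obtain ⟨c', hc', hcG, u, hu, hGu⟩ := exists_colBound G
  obtain ⟨x, hx, hV⟩ := exists_saddle_error hτ (mul_nonneg hc hc') h
  have hF := frobenius_norm_colBound_of_conjTranspose hcF hc
  have hG := frobenius_norm_colBound_of_conjTranspose (A := Gᴴ)
    (by simpa using hcG) hc'
  obtain ⟨a, hac, has, hax⟩ := exists_gains_le (fun i => k i + x i) hc hc' hF hG
  have hxε : ‖realDiagonal x‖ ≤ ε := by
    rw [← sq_le_sq₀ (norm_nonneg _) hε, frobenius_sq_realDiagonal]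
    exact hx
  obtain ⟨E, hE, hle⟩ := exists_error_ge (K := realDiagonal k) hε hxε hu hw hFw hGu
  refine ⟨E, hE, (hV a hac).trans ?_⟩
  have hadd : realDiagonal k + realDiagonal x = realDiagonal fun i => k i + x i := by
    rw [realDiagonal, realDiagonal, Matrix.diagonal_add, realDiagonal]
    simp
  rw [hadd, frobenius_sq_realDiagonal] at hle
  have h1 : (∑ i, |a i|) ^ 2 ≤ (‖F‖ * ‖G‖) ^ 2 :=
    pow_le_pow_left₀ (Finset.sum_nonneg fun _ _ => abs_nonneg _) has 2
  have h2 := mul_le_mul_of_nonneg_left h1 hτ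
  unfold gainError
  linarith

/-- Gains |a_i| k_i/γ_i on the channel γ imitate a on k, and errors shrink by the same ratio. A
negative gain only increases the error once x_i is replaced by |x_i|. -/
theorem exists_error_of_singularValues_le {L : ℕ} {k γ : Fin L → ℝ} {ε τ V : ℝ}
    (hk : ∀ i, 0 ≤ k i) (hkγ : ∀ i, k i ≤ γ i) (hτ : 0 ≤ τ)
    (h : ∀ a : Fin L → ℝ, (∀ i, 0 ≤ a i) →
      ∃ x ∈ coordBall L ε, V ≤ gainError γ a x + τ * (∑ i, a i) ^ 2) (a : Fin L → ℝ) :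
    ∃ x ∈ coordBall L ε, V ≤ gainError k a x + τ * (∑ i, |a i|) ^ 2 := by
  set ρ : Fin L → ℝ := fun i => k i / γ i with hρ
  have hρ0 : ∀ i, 0 ≤ ρ i := fun i => div_nonneg (hk i) ((hk i).trans (hkγ i))
  have hρ1 : ∀ i, ρ i ≤ 1 := fun i => div_le_one_of_le₀ (hkγ i) ((hk i).trans (hkγ i))
  have hργ : ∀ i, ρ i * γ i = k i := fun i => by
    refine div_mul_cancel_of_imp fun h0 => le_antisymm ?_ (hk i)
    exact h0 ▸ hkγ i
  obtain ⟨x, hx, hV⟩ := h (fun i => |a i| * ρ i) fun i => mul_nonneg (abs_nonneg _) (hρ0 i)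
  refine ⟨fun i => if 0 ≤ a i then ρ i * x i else ρ i * |x i|, ?_, hV.trans (add_le_add ?_ ?_)⟩
  · rw [mem_coordBall] at *
    refine (Finset.sum_le_sum fun i _ => ?_).trans hx
    have h1 : ρ i ^ 2 * x i ^ 2 ≤ x i ^ 2 :=
      mul_le_of_le_one_left (sq_nonneg _) (pow_le_one₀ (hρ0 i) (hρ1 i))
    split_ifs
    · rwa [mul_pow]
    · rwa [mul_pow, sq_abs]
  · refine Finset.sum_le_sum fun i _ => ?_
    dsimp only
    split_ifs with h0
    · rw [abs_of_nonneg h0, ← hργ]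
      apply le_of_eq
      ring
    · have h1 : 0 ≤ |a i| * k i := mul_nonneg (abs_nonneg _) (hk i)
      have h2 : 0 ≤ |a i| * ρ i := mul_nonneg (abs_nonneg _) (hρ0 i)
      have h3 : |a i| = - a i := abs_of_neg (not_le.1 h0)
      have h4 := mul_le_mul_of_nonneg_left (le_abs_self (x i)) h2
      have h5 := mul_le_mul_of_nonneg_left (neg_abs_le (x i)) h2
      have h6 : |a i| * ρ i * (γ i + x i) = |a i| * k i + |a i| * ρ i * x i := by
        rw [← hργ]; ring
      have h7 : (a i * (k i + ρ i * |x i|) - 1) ^ 2 =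
          (|a i| * k i + |a i| * ρ i * |x i| + 1) ^ 2 := by
        rw [h3]; ring
      rw [h6, h7]
      exact sq_le_sq' (by linarith) (by linarith)
  · gcongr with i
    · exact Finset.sum_nonneg fun i _ => mul_nonneg (abs_nonneg _) (hρ0 i)
    · exact mul_le_of_le_one_right (abs_nonneg _) (hρ1 i)

/-- The worst-case design problem for parallel scalar channels has a solution. -/
theorem exists_optimal_gains {L : ℕ} {γ : Fin L → ℝ} (hγ : ∀ i, 0 ≤ γ i) {ε τ : ℝ}
    (hτ : 0 ≤ τ) :
    ∃ a x : Fin L → ℝ, (∀ i, 0 ≤ a i) ∧ x ∈ coordBall L ε ∧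
      (∀ y ∈ coordBall L ε, gainError γ a y ≤ gainError γ a x) ∧
      ∀ b : Fin L → ℝ, (∀ i, 0 ≤ b i) → ∃ y ∈ coordBall L ε,
        gainError γ a x + τ * (∑ i, a i) ^ 2 ≤ gainError γ b y + τ * (∑ i, b i) ^ 2 := by
  set m : (Fin L → ℝ) → ℝ := fun a => sSup ((fun x => gainError γ a x) '' coordBall L ε) with hm
  have hmax : ∀ a, ∃ x ∈ coordBall L ε, m a = gainError γ a x ∧
      ∀ y ∈ coordBall L ε, gainError γ a y ≤ gainError γ a x := by
    intro a
    obtain ⟨x, hx, hxm⟩ := (isCompact_coordBall L ε).exists_isMaxOn ⟨0, zero_mem_coordBall L ε⟩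
      (f := fun x => gainError γ a x)
      ((continuous_gainError γ).comp (by fun_prop : Continuous fun x => (a, x))).continuousOn
    refine ⟨x, hx, IsGreatest.csSup_eq ⟨⟨x, hx, rfl⟩, ?_⟩, fun y hy => hxm hy⟩
    rintro _ ⟨y, hy, rfl⟩
    exact hxm hy
  have hmcont : Continuous m :=
    (isCompact_coordBall L ε).continuous_sSup (continuous_gainError γ)
  suffices hsuff : ∃ a : Fin L → ℝ, (∀ i, 0 ≤ a i) ∧ ∀ b : Fin L → ℝ,
      (∀ i, 0 ≤ b i) → m a + τ * (∑ i, a i) ^ 2 ≤ m b + τ * (∑ i, b i) ^ 2 by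
    obtain ⟨a, ha⟩ := hsuff
    obtain ⟨x, hx, hmx, hxm⟩ := hmax a
    refine ⟨a, x, ha.1, hx, hxm, fun b hb => ?_⟩
    obtain ⟨y, hy, hmy, -⟩ := hmax b
    exact ⟨y, hy, by rw [← hmx, ← hmy]; exact ha.2 b hb⟩
  have hle : ∀ a, ∀ y ∈ coordBall L ε, gainError γ a y ≤ m a := fun a y hy => by
    obtain ⟨x, -, hmx, hxm⟩ := hmax a
    exact hmx ▸ hxm y hy
  -- Without coercivity (ε = τ = 0) the minimiser is explicit: 1/γ, with `0⁻¹ = 0` since a dead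
  -- channel costs 1 for any gain.
  rcases (add_nonneg (sq_nonneg ε) hτ).eq_or_lt with h0 | hpos
  · have hε0 : ε = 0 := by
      have := sq_nonneg ε
      exact pow_eq_zero_iff two_ne_zero |>.1 (by linarith)
    have hτ0 : τ = 0 := by
      have := sq_nonneg ε
      linarith
    refine ⟨fun i => (γ i)⁻¹, fun i => inv_nonneg.2 (hγ i), fun b _ => ?_⟩
    rw [hτ0, zero_mul, zero_mul, add_zero, add_zero]
    refine le_trans ?_ (hle b 0 (zero_mem_coordBall L ε))
    obtain ⟨x, hx, hmx, -⟩ := hmax fun i => (γ i)⁻¹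
    have hx0 : ∀ i, x i = 0 := by
      rw [mem_coordBall, hε0, zero_pow two_ne_zero] at hx
      intro i
      have := (Finset.single_le_sum (f := fun j => x j ^ 2) (fun _ _ => sq_nonneg _)
        (Finset.mem_univ i)).trans hx
      exact pow_eq_zero_iff two_ne_zero |>.1 (le_antisymm this (sq_nonneg _))
    rw [hmx]
    refine Finset.sum_le_sum fun i _ => ?_
    rw [hx0, Pi.zero_apply, add_zero]
    by_cases hγ0 : γ i = 0
    · rw [hγ0]
      simp
    · rw [inv_mul_cancel₀ hγ0, sub_self, zero_pow two_ne_zero]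
      positivity
  -- Chosen so that outside the box [0, R]^L the objective is at least L, its value at zero gains.
  · set R : ℝ := L / (ε ^ 2 + τ) + 1 with hR
    have hR1 : 1 ≤ R := by
      rw [hR]
      have : (0 : ℝ) ≤ L / (ε ^ 2 + τ) := by positivity
      linarith
    have hRL : (L : ℝ) ≤ R ^ 2 * (ε ^ 2 + τ) := by
      have h1 : (L : ℝ) ≤ R * (ε ^ 2 + τ) := by
        rw [hR, add_mul, div_mul_cancel₀ _ hpos.ne']
        linarith
      refine h1.trans (mul_le_mul_of_nonneg_right ?_ hpos.le)
      nlinarith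
    have hcoer : ∀ b : Fin L → ℝ, (∀ i, 0 ≤ b i) → ∀ i,
        b i ^ 2 * (ε ^ 2 + τ) ≤ m b + τ * (∑ i, b i) ^ 2 := by
      intro b hb i
      have h1 : b i ^ 2 * ε ^ 2 ≤ m b := by
        -- Averaging the errors ±ε in coordinate i gives (b_i γ_i - 1)² + b_i² ε².
        have h2 : ∀ s : ℝ, s ^ 2 = ε ^ 2 → (b i * (γ i + s) - 1) ^ 2 ≤ m b := by
          intro s hs
          have hmem : Pi.single i s ∈ coordBall L ε := by
            rw [mem_coordBall, Finset.sum_eq_single i (fun j _ hj => by simp [hj]) (by simp)]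
            rw [Pi.single_eq_same, hs]
          refine le_trans ?_ (hle b _ hmem)
          have := Finset.single_le_sum
            (f := fun j => (b j * (γ j + Pi.single (M := fun _ => ℝ) i s j) - 1) ^ 2)
            (fun _ _ => sq_nonneg _) (Finset.mem_univ i)
          simpa [gainError] using this
        have h3 := h2 ε rfl
        have h4 := h2 (-ε) (neg_sq ε)
        nlinarith [sq_nonneg (b i * γ i - 1)]
      have h2 : b i ^ 2 ≤ (∑ i, b i) ^ 2 :=
        pow_le_pow_left₀ (hb i) (Finset.single_le_sum (fun j _ => hb j) (Finset.mem_univ i)) 2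
      nlinarith [mul_le_mul_of_nonneg_left h2 hτ]
    obtain ⟨a, ha, hamin⟩ := (isCompact_Icc (a := (0 : Fin L → ℝ)) (b := fun _ => R)).exists_isMinOn
      ⟨0, le_rfl, fun i => by simp only [Pi.zero_apply]; linarith⟩
      (f := fun b => m b + τ * (∑ i, b i) ^ 2) (by fun_prop)
    refine ⟨a, ha.1, fun b hb => ?_⟩
    by_cases hbR : ∀ i, b i ≤ R
    · exact hamin (show b ∈ Set.Icc _ _ from ⟨hb, hbR⟩)
    · push Not at hbR
      obtain ⟨i, hi⟩ := hbR
      have h1 : m a + τ * (∑ i, a i) ^ 2 ≤ m 0 + τ * (∑ i, (0 : Fin L → ℝ) i) ^ 2 :=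
        hamin (show (0 : Fin L → ℝ) ∈ Set.Icc _ _ from
          ⟨le_rfl, fun i => by simp only [Pi.zero_apply]; linarith⟩)
      have h2 : m 0 = L := by
        obtain ⟨x, -, hmx, -⟩ := hmax 0
        rw [hmx]
        simp [gainError]
      rw [h2] at h1
      simp only [Pi.zero_apply, Finset.sum_const_zero, ne_eq, OfNat.ofNat_ne_zero,
        not_false_eq_true, zero_pow, mul_zero, add_zero] at h1
      refine h1.trans (hRL.trans (le_trans ?_ (hcoer b hb i)))
      gcongr

/-! ### Coordinate isometries and rectangular diagonals. -/

/-- The `m × k` matrix whose columns are the first `k` standard basis vectors. -/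
noncomputable def coordIsometry {m k : ℕ} (h : k ≤ m) : Matrix (Fin m) (Fin k) ℂ :=
  (1 : Matrix (Fin m) (Fin m) ℂ).submatrix id (Fin.castLE h)

theorem coordIsometry_isometry {m k : ℕ} (h : k ≤ m) :
    (coordIsometry h)ᴴ * coordIsometry h = 1 := by
  rw [coordIsometry, Matrix.conjTranspose_submatrix,
    ← Matrix.submatrix_mul _ _ _ _ _ Function.bijective_id, Matrix.conjTranspose_one,
    Matrix.one_mul, Matrix.submatrix_one _ (Fin.castLE_injective h)]

theorem coordIsometry_self {k : ℕ} (h : k ≤ k) : coordIsometry h = 1 := by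
  exact Matrix.submatrix_id_id 1

theorem coordIsometry_compress {m n k : ℕ} (hm : k ≤ m) (hn : k ≤ n)
    (T : Matrix (Fin m) (Fin n) ℂ) :
    (coordIsometry hm)ᴴ * T * coordIsometry hn = T.submatrix (Fin.castLE hm) (Fin.castLE hn) := by
  conv_lhs => rw [← Matrix.submatrix_id_id T]
  rw [coordIsometry, coordIsometry, Matrix.conjTranspose_submatrix, Matrix.conjTranspose_one,
    ← Matrix.submatrix_mul _ _ _ _ _ Function.bijective_id,
    ← Matrix.submatrix_mul _ _ _ _ _ Function.bijective_id, Matrix.one_mul, Matrix.mul_one]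

theorem rectDiag_eq {m n k : ℕ} (hm : k ≤ m) (hn : k ≤ n) (d : Fin k → ℝ) :
    rectDiag m n d = coordIsometry hm * realDiagonal d * (coordIsometry hn)ᴴ := by
  ext i j
  rw [Matrix.mul_apply]
  simp only [realDiagonal, Matrix.mul_diagonal, coordIsometry, Matrix.submatrix_apply, id_eq,
    Matrix.conjTranspose_apply, Matrix.one_apply, rectDiag, Matrix.of_apply]
  split_ifs with h
  · rw [Finset.sum_eq_single ⟨i, h.2⟩]
    · have h1 : i = Fin.castLE hm ⟨i, h.2⟩ := Fin.ext rfl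
      have h2 : j = Fin.castLE hn ⟨i, h.2⟩ := Fin.ext h.1.symm
      simp [← h1, ← h2]
    · intro b _ hb
      have h1 : i ≠ Fin.castLE hm b := fun h' => hb (Fin.ext (Fin.ext_iff.1 h').symm)
      simp [h1]
    · simp
  · symm
    refine Finset.sum_eq_zero fun b _ => ?_
    by_cases h1 : i = Fin.castLE hm b
    · have : j ≠ Fin.castLE hn b := by
        rintro h2
        exact h ⟨by rw [h1, h2]; rfl, by rw [h1]; exact b.2⟩
      simp [this]
    · simp [h1]

theorem coordIsometry_compress_rectDiag {M N L : ℕ} (hM : L ≤ M) (hN : L ≤ N)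
    (γ : Fin (min M N) → ℝ) :
    (coordIsometry hM)ᴴ * rectDiag M N γ * coordIsometry hN =
      realDiagonal fun i => γ (Fin.castLE (le_min hM hN) i) := by
  rw [coordIsometry_compress]
  ext i j
  by_cases h : i = j
  · subst h
    have : i.val < min M N := i.2.trans_le (le_min hM hN)
    simp only [Matrix.submatrix_apply, rectDiag, Matrix.of_apply, Fin.val_castLE, this, and_self,
      dite_true, realDiagonal, Matrix.diagonal_apply_eq]
    rfl
  · have : ¬ (i.val = j.val ∧ i.val < min M N) := fun h' => h (Fin.ext h'.1)
    simp only [Matrix.submatrix_apply, rectDiag, Matrix.of_apply, Fin.val_castLE, this,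
      dite_false, realDiagonal, Matrix.diagonal_apply_ne _ h]

/-! ### Worst errors of diagonal pairs. -/

theorem diagonal_error_apply {L : ℕ} (f g γ : Fin L → ℝ) (e : Matrix (Fin L) (Fin L) ℂ)
    (i j : Fin L) : (realDiagonal g * (realDiagonal γ + e) * realDiagonal f - 1) i j =
      (g i * f j : ℝ) * e i j + if i = j then ((f i * g i * γ i - 1 : ℝ) : ℂ) else 0 := by
  simp only [realDiagonal, Matrix.mul_diagonal, Matrix.diagonal_mul, Matrix.sub_apply,
    Matrix.add_apply, Matrix.one_apply, Matrix.diagonal_apply]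
  split_ifs with h
  · subst h
    push_cast
    ring
  · push_cast
    ring

theorem diagonal_error_realDiagonal {L : ℕ} (f g γ x : Fin L → ℝ) :
    ‖realDiagonal g * (realDiagonal γ + realDiagonal x) * realDiagonal f - 1‖ ^ 2 =
      gainError γ (fun i => f i * g i) x := by
  have : realDiagonal g * (realDiagonal γ + realDiagonal x) * realDiagonal f - 1 =
      realDiagonal fun i => f i * g i * (γ i + x i) - 1 := by
    ext i j
    rw [diagonal_error_apply]
    by_cases h : i = j
    · subst h
      simp [realDiagonal]
      ring
    · simp [realDiagonal, h]
  rw [this, frobenius_sq_realDiagonal, gainError]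

/-- For gains split evenly between precoder and equalizer, some diagonal channel error is at least
as bad as a given one. -/
theorem exists_diagonal_error_ge {L : ℕ} {f g a γ : Fin L → ℝ} {ε : ℝ}
    (ha : ∀ i, 0 ≤ a i) (hfg : ∀ i, f i * g i = a i)
    (hgf : ∀ i j, (g i * f j) ^ 2 = a i * a j) {e : Matrix (Fin L) (Fin L) ℂ} (he : ‖e‖ ≤ ε) :
    ∃ x ∈ coordBall L ε,
      ‖realDiagonal g * (realDiagonal γ + e) * realDiagonal f - 1‖ ^ 2 ≤ gainError γ a x := by
  rcases Nat.eq_zero_or_pos L with rfl | hL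
  · refine ⟨0, zero_mem_coordBall 0 ε, ?_⟩
    rw [frobenius_sq_eq_sum]
    simp [gainError]
  have : Nonempty (Fin L) := ⟨⟨0, hL⟩⟩
  -- All off-diagonal energy O is moved to the entry (p, p), where the gain is largest.
  obtain ⟨p, hp⟩ := Finite.exists_max a
  set o : Fin L → ℝ := fun i => ∑ j ∈ Finset.univ.erase i, ‖e i j‖ ^ 2 with ho
  have ho0 : ∀ i, 0 ≤ o i := fun i => Finset.sum_nonneg fun _ _ => by positivity
  have hO : 0 ≤ ∑ i, o i := Finset.sum_nonneg fun i _ => ho0 i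
  set O := ∑ i, o i
  have hrow : ∀ i, ∑ j, ‖e i j‖ ^ 2 = ‖e i i‖ ^ 2 + o i := fun i =>
    (Finset.add_sum_erase _ (fun j => ‖e i j‖ ^ 2) (Finset.mem_univ i)).symm
  have heε : ∑ i, ‖e i i‖ ^ 2 + O ≤ ε ^ 2 := by
    rw [← Finset.sum_add_distrib]
    simp only [← hrow]
    rw [← frobenius_sq_eq_sum]
    exact pow_le_pow_left₀ (norm_nonneg _) he 2
  set z : Fin L → ℝ := fun i => √(‖e i i‖ ^ 2 + if i = p then O else 0) with hz
  have hz2 : ∀ i, z i ^ 2 = ‖e i i‖ ^ 2 + if i = p then O else 0 := fun i =>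
    Real.sq_sqrt (add_nonneg (sq_nonneg _) (by split_ifs <;> simp [hO]))
  have hz0 : ∀ i, 0 ≤ z i := fun i => Real.sqrt_nonneg _
  have hze : ∀ i, ‖e i i‖ ≤ z i := fun i =>
    Real.le_sqrt_of_sq_le (le_add_of_nonneg_right (by split_ifs <;> simp [hO]))
  -- Signs that push each residual a_i γ_i - 1 away from 0.
  set s : Fin L → ℝ := fun i => if 0 ≤ a i * γ i - 1 then 1 else -1 with hs
  refine ⟨fun i => s i * z i, ?_, ?_⟩
  · rw [mem_coordBall]
    have : ∀ i, (s i * z i) ^ 2 = z i ^ 2 := fun i => by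
      simp only [hs]
      split_ifs <;> ring
    simp only [this, hz2, Finset.sum_add_distrib, Finset.sum_ite_eq', Finset.mem_univ, if_true]
    exact heε
  · have hterm : ∀ i, (a i * (γ i + s i * z i) - 1) ^ 2 = (|a i * γ i - 1| + a i * z i) ^ 2 := by
      intro i
      simp only [hs]
      split_ifs with h
      · rw [abs_of_nonneg h]; ring
      · rw [abs_of_neg (not_le.1 h)]; ring
    have hrowle : ∀ i,
        ∑ j, ‖(realDiagonal g * (realDiagonal γ + e) * realDiagonal f - 1) i j‖ ^ 2 ≤
          (|a i * γ i - 1| + a i * ‖e i i‖) ^ 2 + a p ^ 2 * o i := by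
      intro i
      rw [← Finset.add_sum_erase _ _ (Finset.mem_univ i), ho, Finset.mul_sum]
      refine add_le_add ?_ (Finset.sum_le_sum fun j hj => ?_)
      · rw [diagonal_error_apply, if_pos rfl, hfg, mul_comm (g i), hfg]
        refine pow_le_pow_left₀ (norm_nonneg _) ((norm_add_le _ _).trans ?_) 2
        rw [norm_mul, Complex.norm_real, Complex.norm_real, Real.norm_eq_abs, Real.norm_eq_abs,
          abs_of_nonneg (ha i)]
        linarith
      · rw [diagonal_error_apply, if_neg (Finset.ne_of_mem_erase hj).symm, add_zero, norm_mul,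
          mul_pow, Complex.norm_real, Real.norm_eq_abs, sq_abs, hgf, sq (a p)]
        exact mul_le_mul_of_nonneg_right (mul_le_mul (hp i) (hp j) (ha j) (ha p)) (by positivity)
    rw [frobenius_sq_eq_sum, gainError]
    simp only [hterm]
    calc _ ≤ ∑ i, ((|a i * γ i - 1| + a i * ‖e i i‖) ^ 2 + a p ^ 2 * o i) :=
          Finset.sum_le_sum fun i _ => hrowle i
      _ = ∑ i, ((|a i * γ i - 1| + a i * ‖e i i‖) ^ 2 + if i = p then a p ^ 2 * O else 0) := by
          rw [Finset.sum_add_distrib, Finset.sum_add_distrib, ← Finset.mul_sum,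
            Finset.sum_ite_eq', if_pos (Finset.mem_univ p)]
      _ ≤ _ := by
          refine Finset.sum_le_sum fun i _ => ?_
          have h1 := mul_le_mul_of_nonneg_left (hze i)
            (mul_nonneg (abs_nonneg (a i * γ i - 1)) (ha i))
          have h2 : a i ^ 2 * z i ^ 2 = a i ^ 2 * ‖e i i‖ ^ 2 + if i = p then a p ^ 2 * O else 0 := by
            rw [hz2]
            split_ifs with h
            · subst h; ring
            · ring
          nlinarith

/-! ### Compression to L × L blocks and conclusion. -/

theorem mse_diagonal {M N L : ℕ} {H E : Matrix (Fin M) (Fin N) ℂ} {σ : ℝ}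
    {Q : Matrix (Fin M) (Fin L) ℂ} {W : Matrix (Fin N) (Fin L) ℂ} {γ : Fin L → ℝ}
    (hQ : Qᴴ * Q = 1) (hH : Qᴴ * H * W = realDiagonal γ) (f g : Fin L → ℝ) :
    mse H σ (W * realDiagonal f) (realDiagonal g * Qᴴ) E =
      ‖realDiagonal g * (realDiagonal γ + Qᴴ * E * W) * realDiagonal f - 1‖ ^ 2 +
        σ ^ 2 * ∑ i, g i ^ 2 := by
  rw [mse, frobenius_norm_mul_coisometry hQ, frobenius_sq_realDiagonal, ← hH]
  congr 3
  simp only [Matrix.mul_add, Matrix.add_mul, Matrix.mul_assoc]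

theorem powerFeasible_iff {N L : ℕ} {P : ℝ} {F : Matrix (Fin N) (Fin L) ℂ} :
    PowerFeasible P F ↔ ‖F‖ ^ 2 ≤ P := by
  rw [PowerFeasible, Matrix.trace_mul_comm, frobenius_sq_eq_trace]

theorem mse_le_worstCaseMSE {M N L : ℕ} {H E : Matrix (Fin M) (Fin N) ℂ} {ε σ : ℝ}
    {F : Matrix (Fin N) (Fin L) ℂ} {G : Matrix (Fin L) (Fin M) ℂ} (hE : ‖E‖ ≤ ε) :
    mse H σ F G E ≤ worstCaseMSE H ε σ F G := by
  obtain ⟨E', hE', h⟩ := exists_isWorstCaseError H ((norm_nonneg E).trans hE) σ F G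
  rw [h]
  exact hE'.2 E hE

theorem IsWorstCaseError.worstCaseMSE_eq {M N L : ℕ} {H E : Matrix (Fin M) (Fin N) ℂ} {ε σ : ℝ}
    {F : Matrix (Fin N) (Fin L) ℂ} {G : Matrix (Fin L) (Fin M) ℂ}
    (h : IsWorstCaseError H ε σ F G E) : worstCaseMSE H ε σ F G = mse H σ F G E := by
  refine IsGreatest.csSup_eq ⟨⟨E, h.1, rfl⟩, ?_⟩
  rintro _ ⟨E', hE', rfl⟩
  exact h.2 E' hE'

/-- The optimal value of the parallel scalar problem bounds the worst-case error of every pair. -/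
theorem le_worstCaseMSE_of_forall_gains {M N L : ℕ} (hLM : L ≤ M) (hLN : L ≤ N) {ε σ τ v : ℝ}
    (hε : 0 ≤ ε) (hτ : 0 ≤ τ) {H : Matrix (Fin M) (Fin N) ℂ} {U : Matrix (Fin M) (Fin M) ℂ}
    {γ : Fin (min M N) → ℝ} {V : Matrix (Fin N) (Fin N) ℂ} (hH : IsSVD H U γ V)
    (h : ∀ a : Fin L → ℝ, (∀ i, 0 ≤ a i) → ∃ x ∈ coordBall L ε,
      v ≤ gainError (fun i => γ (Fin.castLE (le_min hLM hLN) i)) a x + τ * (∑ i, a i) ^ 2)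
    (F : Matrix (Fin N) (Fin L) ℂ) (G : Matrix (Fin L) (Fin M) ℂ)
    (hFG : τ * (‖F‖ * ‖G‖) ^ 2 ≤ σ ^ 2 * ‖G‖ ^ 2) : v ≤ worstCaseMSE H ε σ F G := by
  obtain ⟨Q, R, hQ, hF⟩ := exists_isometry_mul hLN F
  obtain ⟨Q', R', hQ', hG⟩ := exists_isometry_mul hLM Gᴴ
  replace hG : G = R'ᴴ * Q'ᴴ := by
    rw [← Matrix.conjTranspose_mul, ← hG, Matrix.conjTranspose_conjTranspose]
  obtain ⟨A, B, k, hA, hB, hk, hk', hK⟩ := exists_svd (Q'ᴴ * H * Q)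
  have hA' : A * Aᴴ = 1 := mul_eq_one_comm.1 hA
  have hB' : B * Bᴴ = 1 := mul_eq_one_comm.1 hB
  have hU : U * Uᴴ = 1 := Matrix.mem_unitaryGroup_iff.1 hH.left_unitary
  have hV : V * Vᴴ = 1 := Matrix.mem_unitaryGroup_iff.1 hH.right_unitary
  have hC : (Uᴴ * (Q' * A))ᴴ * (Uᴴ * (Q' * A)) = 1 :=
    conjTranspose_mul_isometry (by simpa using hU) (conjTranspose_mul_isometry hQ' hA)
  have hD : (Vᴴ * (Q * B))ᴴ * (Vᴴ * (Q * B)) = 1 :=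
    conjTranspose_mul_isometry (by simpa using hV) (conjTranspose_mul_isometry hQ hB)
  have hkdiag : (Uᴴ * (Q' * A))ᴴ * rectDiag M N γ * (Vᴴ * (Q * B)) = realDiagonal k := by
    calc (Uᴴ * (Q' * A))ᴴ * rectDiag M N γ * (Vᴴ * (Q * B))
        = Aᴴ * (Q'ᴴ * (U * rectDiag M N γ * Vᴴ) * Q) * B := by
          simp only [Matrix.conjTranspose_mul, Matrix.conjTranspose_conjTranspose,
            Matrix.mul_assoc]
      _ = (Aᴴ * A) * realDiagonal k * (Bᴴ * B) := by
          rw [← hH.eq_mul, hK]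
          simp only [Matrix.mul_assoc]
      _ = realDiagonal k := by rw [hA, hB, Matrix.one_mul, Matrix.mul_one]
  -- Compression by isometries cannot raise singular values.
  have hkγ : ∀ i, k i ≤ γ (Fin.castLE (le_min hLM hLN) i) := by
    intro i
    have := le_mul_of_mul_mul_eq_realDiagonal (c := 1) (frobenius_norm_coisometry_mul_le hC)
      (fun v => by rw [frobenius_norm_isometry_mul hD, one_mul]) hk hk' hkdiag i
      (hH.nonneg (Fin.castLE (le_min hLM hLN) i))
      (norm_rectDiag_mul_col_le hH.nonneg hH.antitone (Fin.castLE (le_min hLM hLN) i))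
    rwa [mul_one] at this
  obtain ⟨E, hE, hle⟩ := exists_error_of_forall_gains hε hτ
    (exists_error_of_singularValues_le hk hkγ hτ h) (Bᴴ * R) (R'ᴴ * A)
  have hFn : ‖Bᴴ * R‖ = ‖F‖ := by
    rw [frobenius_norm_isometry_mul (by simpa using hB'), hF, frobenius_norm_isometry_mul hQ]
  have hGn : ‖R'ᴴ * A‖ = ‖G‖ := by
    have := frobenius_norm_mul_coisometry (W := Aᴴ) (by simpa using hA') R'ᴴ
    rw [Matrix.conjTranspose_conjTranspose] at this
    rw [this, hG, frobenius_norm_mul_coisometry hQ']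
  -- The L × L error is lifted by isometries, which preserve its norm.
  have hEn : ‖Q' * A * E * (Q * B)ᴴ‖ ≤ ε := by
    rwa [frobenius_norm_mul_coisometry (conjTranspose_mul_isometry hQ hB),
      frobenius_norm_isometry_mul (conjTranspose_mul_isometry hQ' hA)]
  refine le_trans ?_ (mse_le_worstCaseMSE hEn)
  have hprod : G * (H + Q' * A * E * (Q * B)ᴴ) * F =
      R'ᴴ * A * (realDiagonal k + E) * (Bᴴ * R) := by
    have h1 : A * realDiagonal k * Bᴴ = Q'ᴴ * H * Q := hK.symm
    calc G * (H + Q' * A * E * (Q * B)ᴴ) * F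
        = R'ᴴ * (Q'ᴴ * H * Q + (Q'ᴴ * Q') * (A * E * Bᴴ) * (Qᴴ * Q)) * R := by
          rw [hF, hG]
          simp only [Matrix.conjTranspose_mul, Matrix.mul_add, Matrix.add_mul, Matrix.mul_assoc]
      _ = _ := by
          rw [hQ, hQ', Matrix.one_mul, Matrix.mul_one, ← h1]
          simp only [Matrix.mul_add, Matrix.add_mul, Matrix.mul_assoc]
  rw [mse, hprod]
  rw [hFn, hGn] at hle
  linarith

theorem theorem1 (M N L : ℕ) (hLM : L ≤ M) (hLN : L ≤ N) (P ε σ : ℝ) (hP : 0 ≤ P) (hε : 0 ≤ ε)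
    (H : Matrix (Fin M) (Fin N) ℂ) (U : Matrix (Fin M) (Fin M) ℂ)
    (γ : Fin (min M N) → ℝ) (V : Matrix (Fin N) (Fin N) ℂ) (hH : IsSVD H U γ V) :
    ∃ f g x : Fin L → ℝ,
      IsRobustOptimal H P ε σ (V * rectDiag N L f) (rectDiag L M g * Uᴴ) ∧
      IsWorstCaseError H ε σ (V * rectDiag N L f) (rectDiag L M g * Uᴴ)
        (U * rectDiag M N x * Vᴴ) := by
  have hU : Uᴴ * U = 1 := Matrix.mem_unitaryGroup_iff'.1 hH.left_unitary
  have hV : Vᴴ * V = 1 := Matrix.mem_unitaryGroup_iff'.1 hH.right_unitary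
  set γ' : Fin L → ℝ := fun i => γ (Fin.castLE (le_min hLM hLN) i) with hγ'
  set Q := U * coordIsometry hLM with hQdef
  set W := V * coordIsometry hLN with hWdef
  have hQ : Qᴴ * Q = 1 := conjTranspose_mul_isometry hU (coordIsometry_isometry hLM)
  have hW : Wᴴ * W = 1 := conjTranspose_mul_isometry hV (coordIsometry_isometry hLN)
  have hQHW : Qᴴ * H * W = realDiagonal γ' := by
    calc Qᴴ * H * W = (coordIsometry hLM)ᴴ * ((Uᴴ * U) * rectDiag M N γ * (Vᴴ * V)) *
          coordIsometry hLN := by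
          rw [hH.eq_mul, hQdef, hWdef]
          simp only [Matrix.conjTranspose_mul, Matrix.mul_assoc]
      _ = _ := by
          rw [hU, hV, Matrix.one_mul, Matrix.mul_one, coordIsometry_compress_rectDiag]
  have hFeq : ∀ f : Fin L → ℝ, V * rectDiag N L f = W * realDiagonal f := fun f => by
    rw [rectDiag_eq hLN le_rfl, coordIsometry_self, Matrix.conjTranspose_one, Matrix.mul_one,
      ← Matrix.mul_assoc]
  have hGeq : ∀ g : Fin L → ℝ, rectDiag L M g * Uᴴ = realDiagonal g * Qᴴ := fun g => by
    rw [rectDiag_eq le_rfl hLM, coordIsometry_self, Matrix.one_mul, hQdef,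
      Matrix.conjTranspose_mul, Matrix.mul_assoc]
  have hEeq : ∀ x : Fin L → ℝ, U * rectDiag M N x * Vᴴ = Q * realDiagonal x * Wᴴ := fun x => by
    rw [rectDiag_eq hLM hLN, hQdef, hWdef]
    simp only [Matrix.conjTranspose_mul, Matrix.mul_assoc]
  have hEcomp : ∀ x : Fin L → ℝ, Qᴴ * (Q * realDiagonal x * Wᴴ) * W = realDiagonal x := fun x => by
    calc Qᴴ * (Q * realDiagonal x * Wᴴ) * W = (Qᴴ * Q) * realDiagonal x * (Wᴴ * W) := by
          simp only [Matrix.mul_assoc]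
      _ = _ := by rw [hQ, hW, Matrix.one_mul, Matrix.mul_one]
  have hEnorm : ∀ x : Fin L → ℝ, ‖Q * realDiagonal x * Wᴴ‖ ^ 2 = ∑ i, x i ^ 2 := fun x => by
    rw [frobenius_norm_mul_coisometry hW, frobenius_norm_isometry_mul hQ,
      frobenius_sq_realDiagonal]
  simp only [hFeq, hGeq, hEeq, IsRobustOptimal, powerFeasible_iff]
  -- P = 0 forces F = 0, and then G = 0 is best; otherwise τ = σ²/P makes sense.
  rcases hP.eq_or_lt with hP0 | hPpos
  · have hwc : IsWorstCaseError H ε σ (W * realDiagonal (0 : Fin L → ℝ))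
        (realDiagonal (0 : Fin L → ℝ) * Qᴴ) (Q * realDiagonal (0 : Fin L → ℝ) * Wᴴ) := by
      have h0 : realDiagonal (0 : Fin L → ℝ) = 0 := by simp [realDiagonal]
      refine ⟨?_, fun E' _ => ?_⟩
      · simpa [h0] using hε
      · simp [mse, h0]
    refine ⟨0, 0, 0, ⟨?_, fun F' G' hF' => ?_⟩, hwc⟩
    · rw [frobenius_norm_isometry_mul hW, frobenius_sq_realDiagonal]
      simpa using hP
    · have hF0 : F' = 0 := by
        rw [← hP0] at hF'
        exact norm_eq_zero.1 (pow_eq_zero_iff two_ne_zero |>.1 (le_antisymm hF' (sq_nonneg _)))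
      rw [hwc.worstCaseMSE_eq]
      refine le_trans ?_ (mse_le_worstCaseMSE (E := 0) (by simpa using hε))
      have h0 : realDiagonal (0 : Fin L → ℝ) = 0 := by simp [realDiagonal]
      simp only [mse, h0, hF0, Matrix.mul_zero, Matrix.zero_mul, norm_zero]
      nlinarith [mul_nonneg (sq_nonneg σ) (sq_nonneg ‖G'‖)]
  · have hτ : 0 ≤ σ ^ 2 / P := by positivity
    obtain ⟨a, x, ha, hx, hxmax, hamin⟩ :=
      exists_optimal_gains (γ := γ') (fun i => hH.nonneg _) (ε := ε) hτ
    set S := ∑ i, a i with hS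
    have hS0 : 0 ≤ S := Finset.sum_nonneg fun i _ => ha i
    have haS : ∀ i, S = 0 → a i = 0 := fun i h =>
      (Finset.sum_eq_zero_iff_of_nonneg fun j _ => ha j).1 h i (Finset.mem_univ i)
    -- The split with f proportional to g, the equality case of Cauchy–Schwarz. If S = 0, all gains
    -- vanish and so do f and g.
    set f : Fin L → ℝ := fun i => √(P * a i / S) with hf
    set g : Fin L → ℝ := fun i => √(S * a i / P) with hg
    have hf2 : ∀ i, f i ^ 2 = P * a i / S := fun i =>
      Real.sq_sqrt (div_nonneg (mul_nonneg hP (ha i)) hS0)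
    have hg2 : ∀ i, g i ^ 2 = S * a i / P := fun i =>
      Real.sq_sqrt (div_nonneg (mul_nonneg hS0 (ha i)) hP)
    have hgf : ∀ i j, (g i * f j) ^ 2 = a i * a j := fun i j => by
      rw [mul_pow, hf2, hg2]
      rcases eq_or_ne S 0 with h | h
      · simp [h, haS i h]
      · field_simp
    have hfg : ∀ i, f i * g i = a i := fun i => by
      rw [← sq_eq_sq₀ (mul_nonneg (Real.sqrt_nonneg _) (Real.sqrt_nonneg _)) (ha i), mul_comm,
        hgf, sq]
    have hfP : ∑ i, f i ^ 2 ≤ P := by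
      simp only [hf2]
      rw [← Finset.sum_div, ← Finset.mul_sum, ← hS]
      exact div_le_of_le_mul₀ hS0 hP le_rfl
    have hgs : σ ^ 2 * ∑ i, g i ^ 2 = σ ^ 2 / P * S ^ 2 := by
      simp only [hg2]
      rw [← Finset.sum_div, ← Finset.mul_sum, ← hS]
      ring
    have hmsex : mse H σ (W * realDiagonal f) (realDiagonal g * Qᴴ) (Q * realDiagonal x * Wᴴ) =
        gainError γ' a x + σ ^ 2 / P * S ^ 2 := by
      rw [mse_diagonal hQ hQHW, hEcomp, diagonal_error_realDiagonal, hgs]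
      simp only [hfg]
    have hwc : IsWorstCaseError H ε σ (W * realDiagonal f) (realDiagonal g * Qᴴ)
        (Q * realDiagonal x * Wᴴ) := by
      refine ⟨?_, fun E' hE' => ?_⟩
      · rw [← sq_le_sq₀ (norm_nonneg _) hε, hEnorm]
        exact hx
      · have hcomp : ‖Qᴴ * E' * W‖ ≤ ε := by
          have h1 := frobenius_norm_coisometry_mul_le hW (Qᴴ * E')ᴴ
          rw [← Matrix.conjTranspose_mul, Matrix.frobenius_norm_conjTranspose,
            Matrix.frobenius_norm_conjTranspose] at h1
          exact h1.trans ((frobenius_norm_coisometry_mul_le hQ E').trans hE')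
        obtain ⟨y, hy, hle⟩ := exists_diagonal_error_ge (γ := γ') ha hfg hgf hcomp
        rw [hmsex, mse_diagonal hQ hQHW, hgs]
        have := hxmax y hy
        linarith
    refine ⟨f, g, x, ⟨?_, fun F' G' hF' => ?_⟩, hwc⟩
    · rwa [frobenius_norm_isometry_mul hW, frobenius_sq_realDiagonal]
    · rw [hwc.worstCaseMSE_eq, hmsex]
      refine le_worstCaseMSE_of_forall_gains hLM hLN hε hτ hH hamin F' G' ?_
      rw [mul_pow, ← mul_assoc]
      refine mul_le_mul_of_nonneg_right ?_ (sq_nonneg _)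
      rw [div_mul_eq_mul_div, div_le_iff₀ hPpos]
      exact mul_le_mul_of_nonneg_left hF' (sq_nonneg _)
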